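/- **General recursions for the non-stationary optimal causal reconstruction.** Setting. Let $n\ge 0$, and for $0\le i\le n$ let $\mathcal X_i,\mathcal Y_i$ be Polish spaces with their Borel $\sigma$-algebras; write $x^i=(x_0,\dots,x_i)$, $\mathcal X_{0,i}=\prod_{j\le i}\mathcal X_j$, and similarly for $y$ (strings with index $-1$ are empty). Let the source law be $P_{X^n}=\bigotimes_{i=0}^n P_{X_i|X^{i-1}}$ with stochastic kernels $P_{X_i|X^{i-1}}$, and let $\rho_{0,i}:\mathcal X_{0,i}\times\mathcal Y_{0,i}\to[0,\infty)$ be measurable, $d_{0,n}(x^n,y^n)=\sum_{i=0}^n\rho_{0,i}(x^i,y^i)$. A stochastic kernel $P=P_{Y^n|X^n}$ is *causal* if, for $P_{X^n}$-almost all $x^n$, $P(dy^n|x^n)=\bigotimes_{i=0}^nP_{Y_i|Y^{i-1},X^i}(dy_i|y^{i-1},x^i)$ for some stochastic kernels $P_{Y_i|Y^{i-1},X^i}$. Put $\ell(P)=\int d_{0,n}\,d(P_{X^n}\otimes P)\in[0,\infty]$, let $\mathbb I(P)\in[0,\infty]$ be the mutual information (the Kullback–Leibler divergence of $P_{X^n}\otimes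 P$ from the product of its marginals), and for $D\ge 0$ $$R^c_{0,n}(D)=\inf\{\mathbb I(P): P\text{ causal},\ \ell(P)\le D\}$$ (with $\inf\emptyset=\infty$). A real $s\le 0$ is called a *Lagrange multiplier* at $D$ if $$R^c_{0,n}(D)=\inf_{P\text{ causal}}\{\mathbb I(P)-s(\ell(P)-D)\}\qquad(\text{with }0\cdot\infty=0).$$ Fix $D\ge 0$. (a) Suppose that $R^c_{0,n}(D_1)<\infty$ for some $0\le D_1<D$, and that either $R^c_{0,n}(D)=0$ or $R^c_{0,n}(D_2)<R^c_{0,n}(D)$ for some $D_2\ge0$. Then a Lagrange multiplier $s\le0$ at $D$ exists. (b) Suppose $R^c_{0,n}(D)<\infty$, let $P^*$ be causal with $\ell(P^*)\le D$ and $\mathbb I(P^*)=R^c_{0,n}(D)$, let $P^*_{Y_i|Y^{i-1},X^i}$, $0\le i\le n$, be stochastic kernels whose causal product is $P^*$ ($P_{X^n}$-a.s.), let $P^*_{Y_i|Y^{i-1}}$ be regular conditional distributions of $Y_i$ given $Y^{i-1}$ under $P_{X^n}\otimes P^*$, and let $s\le0$ be a Lagrange multiplier at $D$. Define $g_{i,n}:\mathcal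 X_{0,i}\times\mathcal Y_{0,i}\to[0,\infty]$ backward in time by $g_{n,n}=0$ and, for $i=n-1,\dots,0$, $$g_{i,n}(x^i,y^i)=-\int_{\mathcal X_{i+1}}P_{X_{i+1}|X^i}(dx_{i+1}|x^i)\,\log\int_{\mathcal Y_{i+1}}e^{s\rho_{0,i+1}(x^{i+1},y^{i+1})-g_{i+1,n}(x^{i+1},y^{i+1})}P^*_{Y_{i+1}|Y^i}(dy_{i+1}|y^i)$$ (with $e^{-\infty}=0$, $\log 0=-\infty$), and put $Z_i(x^i,y^{i-1})=\int_{\mathcal Y_i}e^{s\rho_{0,i}-g_{i,n}}P^*_{Y_i|Y^{i-1}}(dy_i|y^{i-1})$. Then: 1. for every $0\le i\le n$ and almost every $(x^i,y^{i-1})$ with respect to the law of $(X^i,Y^{i-1})$ under $P_{X^n}\otimes P^*$, one has $0<Z_i(x^i,y^{i-1})<\infty$ and $$P^*_{Y_i|Y^{i-1},X^i}(dy_i|y^{i-1},x^i)=\frac{e^{s\rho_{0,i}(x^i,y^i)-g_{i,n}(x^i,y^i)}\,P^*_{Y_i|Y^{i-1}}(dy_i|y^{i-1})}{Z_i(x^i,y^{i-1})};$$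 2. for every $0\le i\le n$, $g_{i,n}(X^i,Y^i)$ and $-\log Z_i(X^i,Y^{i-1})\ge0$ have finite expectation under $P_{X^n}\otimes P^*$, and $$R^c_{0,n}(D)=sD+\sum_{i=0}^n\int_{\mathcal X_{0,i-1}\times\mathcal Y_{0,i-1}}\Big(\bigotimes_{j=0}^{i-1}P_{X_j|X^{j-1}}(dx_j|x^{j-1})\otimes P^*_{Y_j|Y^{j-1},X^j}(dy_j|y^{j-1},x^j)\Big)\int_{\mathcal X_i}P_{X_i|X^{i-1}}(dx_i|x^{i-1})\Big(-\int_{\mathcal Y_i}g_{i,n}\,P^*_{Y_i|Y^{i-1},X^i}(dy_i|y^{i-1},x^i)-\log Z_i(x^i,y^{i-1})\Big).$$ -/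

import Mathlib

open MeasureTheory ProbabilityTheory
open scoped NNReal ENNReal

noncomputable section

namespace CausalRDF

universe u v

/-- Strings `(a_0, …, a_{m-1})` of length `m` with `a_j ∈ A j`, as an iterated product. -/
def Hist (A : ℕ → Type u) : ℕ → Type u
  | 0 => PUnit
  | m + 1 => Hist A m × A m

/-- The product σ-algebra on strings. -/
instance instMeasurableSpaceHist (A : ℕ → Type u) [∀ i, MeasurableSpace (A i)] :
    (m : ℕ) → MeasurableSpace (Hist A m)
  | 0 => (inferInstance : MeasurableSpace PUnit)
  | m + 1 =>
    letI := instMeasurableSpaceHist A m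
    (inferInstance : MeasurableSpace (Hist A m × A m))

/-- Append a letter to a string. -/
def Hist.snoc {A : ℕ → Type u} {m : ℕ} (h : Hist A m) (a : A m) : Hist A (m + 1) := (h, a)

/-- Delete the last letter of a string. -/
def Hist.init {A : ℕ → Type u} {m : ℕ} (h : Hist A (m + 1)) : Hist A m := Prod.fst h

theorem Hist.measurable_init {A : ℕ → Type u} [∀ i, MeasurableSpace (A i)] {m : ℕ} :
    Measurable (Hist.init : Hist A (m + 1) → Hist A m) :=
  measurable_fst (α := Hist A m) (β := A m)

variable {X : ℕ → Type u} {Y : ℕ → Type v}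
  [∀ i, MeasurableSpace (X i)] [∀ i, MeasurableSpace (Y i)]

/-- The law of the first `m` source letters, `κ i` being the conditional law of `X_i` given
`(X_0, …, X_{i-1})`. -/
def sourceLaw (κ : ∀ i, Kernel (Hist X i) (X i)) : (m : ℕ) → Measure (Hist X m)
  | 0 => Measure.dirac PUnit.unit
  | m + 1 => (sourceLaw κ m ⊗ₘ κ m : Measure (Hist X m × X m))

/-- The causal product `⊗_{i < m} q_i(dy_i | y^{i-1}, x^i)` as a kernel from source strings to
reproduction strings; `q i` takes as argument the pair `(x^i, y^{i-1})`. -/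
def causalProduct (q : ∀ i, Kernel (Hist X (i + 1) × Hist Y i) (Y i)) :
    (m : ℕ) → Kernel (Hist X m) (Hist Y m)
  | 0 => Kernel.const _ (Measure.dirac PUnit.unit)
  | m + 1 =>
    ((causalProduct q m).comap Hist.init Hist.measurable_init ⊗ₖ q m :
      Kernel (Hist X (m + 1)) (Hist Y m × Y m))

/-- The joint law of the first `m` source letters and the first `m` reproduction letters. -/
def jointLaw (κ : ∀ i, Kernel (Hist X i) (X i))
    (q : ∀ i, Kernel (Hist X (i + 1) × Hist Y i) (Y i)) (m : ℕ) :
    Measure (Hist X m × Hist Y m) :=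
  sourceLaw κ m ⊗ₘ causalProduct q m

/-- The law of the first `m` reproduction letters. -/
def outputLaw (κ : ∀ i, Kernel (Hist X i) (X i))
    (q : ∀ i, Kernel (Hist X (i + 1) × Hist Y i) (Y i)) (m : ℕ) : Measure (Hist Y m) :=
  (jointLaw κ q m).map Prod.snd

/-- `ν i` is a regular conditional distribution of `Y_i` given `(Y_0, …, Y_{i-1})`, for `i ≤ n`. -/
def IsOutputConditional (κ : ∀ i, Kernel (Hist X i) (X i))
    (q : ∀ i, Kernel (Hist X (i + 1) × Hist Y i) (Y i)) (n : ℕ)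
    (ν : ∀ i, Kernel (Hist Y i) (Y i)) : Prop :=
  ∀ i ≤ n, outputLaw κ q (i + 1) = (outputLaw κ q i ⊗ₘ ν i : Measure (Hist Y i × Y i))

/-- Mutual information `I(μ, P) = D(μ ⊗ P ‖ μ × P_Y)` of an input law and a channel. -/
def mutualInfo {α β : Type*} [MeasurableSpace α] [MeasurableSpace β] (μ : Measure α)
    (P : Kernel α β) : ℝ≥0∞ :=
  InformationTheory.klDiv (μ ⊗ₘ P) (μ.prod ((μ ⊗ₘ P).map Prod.snd))

/-- The additive distortion `∑_{i < m} ρ_i(x^i, y^i)` of two strings of length `m`. -/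
def distortion (ρ : ∀ i, Hist X (i + 1) → Hist Y (i + 1) → ℝ≥0) :
    (m : ℕ) → Hist X m → Hist Y m → ℝ≥0
  | 0, _, _ => 0
  | m + 1, x, y => distortion ρ m x.init y.init + ρ m x y

/-- The average distortion of a channel from `X^n` to `Y^n`. -/
def avgDistortion (κ : ∀ i, Kernel (Hist X i) (X i))
    (ρ : ∀ i, Hist X (i + 1) → Hist Y (i + 1) → ℝ≥0) (n : ℕ)
    (P : Kernel (Hist X (n + 1)) (Hist Y (n + 1))) : ℝ≥0∞ :=
  ∫⁻ z, (distortion ρ (n + 1) z.1 z.2 : ℝ≥0∞) ∂(sourceLaw κ (n + 1) ⊗ₘ P)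

/-- The Markov kernels from `X^n` to `Y^n` that are almost surely equal to a causal product. -/
def causalKernels (κ : ∀ i, Kernel (Hist X i) (X i)) (n : ℕ) :
    Set (Kernel (Hist X (n + 1)) (Hist Y (n + 1))) :=
  {P | IsMarkovKernel P ∧ ∃ q : ∀ i, Kernel (Hist X (i + 1) × Hist Y i) (Y i),
    (∀ i, IsMarkovKernel (q i)) ∧
      ∀ᵐ x ∂(sourceLaw κ (n + 1)), P x = causalProduct q (n + 1) x}

/-- The causal kernels whose average distortion is at most `D`. -/
def fidelitySet (κ : ∀ i, Kernel (Hist X i) (X i))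
    (ρ : ∀ i, Hist X (i + 1) → Hist Y (i + 1) → ℝ≥0) (n : ℕ) (D : ℝ≥0) :
    Set (Kernel (Hist X (n + 1)) (Hist Y (n + 1))) :=
  {P | P ∈ causalKernels κ n ∧ avgDistortion κ ρ n P ≤ D}

/-- The causal rate distortion function (`∞` if no causal kernel meets the constraint). -/
def causalRDF (κ : ∀ i, Kernel (Hist X i) (X i))
    (ρ : ∀ i, Hist X (i + 1) → Hist Y (i + 1) → ℝ≥0) (n : ℕ) (D : ℝ≥0) : ℝ≥0∞ :=
  ⨅ P ∈ fidelitySet κ ρ n D, mutualInfo (sourceLaw κ (n + 1)) P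

/-- `s ≤ 0` is a Lagrange multiplier of the distortion constraint: the constrained infimum
equals the infimum of `I(P) - s (ℓ(P) - D)` over all causal kernels. -/
def IsLagrangeMultiplier (κ : ∀ i, Kernel (Hist X i) (X i))
    (ρ : ∀ i, Hist X (i + 1) → Hist Y (i + 1) → ℝ≥0) (n : ℕ) (D : ℝ≥0) (s : ℝ) : Prop :=
  s ≤ 0 ∧
    (causalRDF κ ρ n D : EReal) =
      ⨅ P ∈ (causalKernels κ n : Set (Kernel (Hist X (n + 1)) (Hist Y (n + 1)))),
        ((mutualInfo (sourceLaw κ (n + 1)) P : EReal) -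
          (s : EReal) * ((avgDistortion κ ρ n P : EReal) - ((D : ℝ) : EReal)))

/-- The weight `e^{s r - g}`, with `e^{-∞} = 0`. -/
def gibbsWeight (s : ℝ) (r : ℝ≥0) (g : ℝ≥0∞) : ℝ≥0∞ :=
  EReal.exp (((s * r : ℝ) : EReal) - (g : EReal))

/-- The backward recursion, indexed by the number `k` of stages that follow stage `i`.
As `s ≤ 0`, the logarithm is nonpositive, so its negative is an element of `[0, ∞]`. -/
def gAux (κ : ∀ i, Kernel (Hist X i) (X i))
    (ρ : ∀ i, Hist X (i + 1) → Hist Y (i + 1) → ℝ≥0)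
    (ν : ∀ i, Kernel (Hist Y i) (Y i)) (s : ℝ) :
    (k i : ℕ) → Hist X (i + 1) → Hist Y (i + 1) → ℝ≥0∞
  | 0, _, _, _ => 0
  | k + 1, i, x, y =>
    ∫⁻ x', (-ENNReal.log (∫⁻ y',
      gibbsWeight s (ρ (i + 1) (x.snoc x') (y.snoc y'))
        (gAux κ ρ ν s k (i + 1) (x.snoc x') (y.snoc y'))
        ∂(ν (i + 1) y))).toENNReal ∂(κ (i + 1) x)

/-- The function `g_{i,n}`, for `i ≤ n`. -/
def g (κ : ∀ i, Kernel (Hist X i) (X i))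
    (ρ : ∀ i, Hist X (i + 1) → Hist Y (i + 1) → ℝ≥0)
    (ν : ∀ i, Kernel (Hist Y i) (Y i)) (s : ℝ) (n i : ℕ) :
    Hist X (i + 1) → Hist Y (i + 1) → ℝ≥0∞ :=
  gAux κ ρ ν s (n - i) i

/-- The Gibbs density `e^{s ρ_i - g_{i,n}}` at `(x^i, (y^{i-1}, y_i))`. -/
def stageWeight (κ : ∀ i, Kernel (Hist X i) (X i))
    (ρ : ∀ i, Hist X (i + 1) → Hist Y (i + 1) → ℝ≥0)
    (ν : ∀ i, Kernel (Hist Y i) (Y i)) (s : ℝ) (n i : ℕ)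
    (x : Hist X (i + 1)) (y : Hist Y i) (y' : Y i) : ℝ≥0∞ :=
  gibbsWeight s (ρ i x (y.snoc y')) (g κ ρ ν s n i x (y.snoc y'))

/-- The partition function `∫ e^{s ρ_i - g_{i,n}} ν_i(dy_i | y^{i-1})`. -/
def partitionFn (κ : ∀ i, Kernel (Hist X i) (X i))
    (ρ : ∀ i, Hist X (i + 1) → Hist Y (i + 1) → ℝ≥0)
    (ν : ∀ i, Kernel (Hist Y i) (Y i)) (s : ℝ) (n i : ℕ)
    (x : Hist X (i + 1)) (y : Hist Y i) : ℝ≥0∞ :=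
  ∫⁻ y', stageWeight κ ρ ν s n i x y y' ∂(ν i y)

end CausalRDF

end

/-!
By the Gibbs variational identity, the divergence of the stage channel `q_i` from `ν_i` plus the
mean of `-s ρ_i + g_{i,n}` equals the divergence of `q_i` from the Gibbs kernel plus the mean of
`-log Z_i`. The recursion makes the mean of `g_{i,n}` the mean of `-log Z_{i+1}`, so the sum over
the stages telescopes: the Lagrangian of an optimal causal channel is the mean of `-log Z_0` plus
the sum of its divergences from the Gibbs kernels. The Lagrangian of the Gibbs channel itself is at
most the mean of `-log Z_0`, hence these divergences vanish at a minimizer.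

The multiplier exists because a mixture of causal joint laws is again a causal joint law. The pairs
(distortion, rate) achievable by causal channels therefore form a convex set up to domination, and a
supporting line of this set at `(D, R(D))` has slope `s`.
-/

open InformationTheory

namespace CausalRDF

universe u v

section Divergence

variable {α β Ω : Type*} [MeasurableSpace α] [MeasurableSpace β] [MeasurableSpace Ω]

theorem klDiv_map_measurableEquiv (μ ν : Measure α) [IsFiniteMeasure μ] [IsFiniteMeasure ν]
    (e : α ≃ᵐ β) : klDiv (μ.map e) (ν.map e) = klDiv μ ν := by
  refine le_antisymm (klDiv_map_le μ ν e.measurable) ?_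
  have h := klDiv_map_le (μ.map e) (ν.map e) e.symm.measurable
  simpa [Measure.map_map e.symm.measurable e.measurable] using h

theorem klDiv_withDensity_self (ν : Measure Ω) [IsFiniteMeasure ν] {f : Ω → ℝ≥0∞}
    (hf : Measurable f) [IsFiniteMeasure (ν.withDensity f)] :
    klDiv (ν.withDensity f) ν = ∫⁻ x, ENNReal.ofReal (klFun (f x).toReal) ∂ν := by
  rw [klDiv_eq_lintegral_klFun_of_ac (withDensity_absolutelyContinuous ν f)]
  refine lintegral_congr_ae ?_
  filter_upwards [Measure.rnDeriv_withDensity ν hf] with x hx using by rw [hx]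

theorem lintegral_map_inl_add_map_inr (μ : Measure α) (ν : Measure β) {f : α ⊕ β → ℝ≥0∞}
    (hf : Measurable f) : ∫⁻ x, f x ∂(μ.map Sum.inl + ν.map Sum.inr) =
      ∫⁻ x, f (.inl x) ∂μ + ∫⁻ x, f (.inr x) ∂ν := by
  rw [lintegral_add_measure, lintegral_map hf measurable_inl, lintegral_map hf measurable_inr]

theorem klDiv_map_inl_add_map_inr {μ₁ ν₁ : Measure α} {μ₂ ν₂ : Measure β}
    [IsFiniteMeasure μ₁] [IsFiniteMeasure μ₂] [IsFiniteMeasure ν₁] [IsFiniteMeasure ν₂]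
    (h₁ : μ₁ ≪ ν₁) (h₂ : μ₂ ≪ ν₂) :
    klDiv (μ₁.map Sum.inl + μ₂.map Sum.inr) (ν₁.map Sum.inl + ν₂.map Sum.inr) =
      klDiv μ₁ ν₁ + klDiv μ₂ ν₂ := by
  let density : α ⊕ β → ℝ≥0∞ := Sum.elim (μ₁.rnDeriv ν₁) (μ₂.rnDeriv ν₂)
  have hdensity : Measurable density :=
    (Measure.measurable_rnDeriv _ _).sumElim (Measure.measurable_rnDeriv _ _)
  have hμ : μ₁.map Sum.inl + μ₂.map Sum.inr =
      (ν₁.map Sum.inl + ν₂.map Sum.inr).withDensity density := by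
    refine Measure.ext_of_lintegral _ fun f hf ↦ ?_
    rw [lintegral_withDensity_eq_lintegral_mul _ hdensity hf,
      lintegral_map_inl_add_map_inr _ _ hf, lintegral_map_inl_add_map_inr _ _ (hdensity.mul hf)]
    congr 1
    · exact (lintegral_rnDeriv_mul h₁ (hf.comp measurable_inl).aemeasurable).symm
    · exact (lintegral_rnDeriv_mul h₂ (hf.comp measurable_inr).aemeasurable).symm
  have : IsFiniteMeasure ((ν₁.map Sum.inl + ν₂.map Sum.inr).withDensity density) := by
    rw [← hμ]; infer_instance
  rw [hμ, klDiv_withDensity_self _ hdensity, lintegral_map_inl_add_map_inr _ _ (by fun_prop),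
    klDiv_eq_lintegral_klFun_of_ac h₁, klDiv_eq_lintegral_klFun_of_ac h₂]
  rfl

/-- Data processing: place the two pairs of measures on disjoint copies of `α`, where divergences
add up, and forget the copy. -/
theorem klDiv_add_le (μ₁ μ₂ ν₁ ν₂ : Measure α)
    [IsFiniteMeasure μ₁] [IsFiniteMeasure μ₂] [IsFiniteMeasure ν₁] [IsFiniteMeasure ν₂] :
    klDiv (μ₁ + μ₂) (ν₁ + ν₂) ≤ klDiv μ₁ ν₁ + klDiv μ₂ ν₂ := by
  by_cases h₁ : μ₁ ≪ ν₁
  swap; · simp [klDiv_of_not_ac h₁]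
  by_cases h₂ : μ₂ ≪ ν₂
  swap; · simp [klDiv_of_not_ac h₂]
  have hforget : Measurable (Sum.elim id id : α ⊕ α → α) := measurable_id.sumElim measurable_id
  have map_forget (μ ν : Measure α) :
      (μ.map Sum.inl + ν.map Sum.inr).map (Sum.elim id id) = μ + ν := by
    rw [Measure.map_add _ _ hforget, Measure.map_map hforget measurable_inl,
      Measure.map_map hforget measurable_inr, Sum.elim_comp_inl, Sum.elim_comp_inr,
      Measure.map_id, Measure.map_id]
  rw [← map_forget μ₁, ← map_forget ν₁, ← klDiv_map_inl_add_map_inr h₁ h₂]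
  exact klDiv_map_le _ _ hforget

/-- `-log Z` as an element of `[0, ∞]`, with `-log 0 = ∞`; it is truncated to `0` for `1 < Z`. -/
noncomputable def negLog (Z : ℝ≥0∞) : ℝ≥0∞ := (-ENNReal.log Z).toENNReal

@[fun_prop]
theorem measurable_negLog : Measurable negLog := by
  unfold negLog; fun_prop

theorem negLog_eq_top_iff {Z : ℝ≥0∞} : negLog Z = ∞ ↔ Z = 0 := by
  rw [negLog, EReal.toENNReal_eq_top_iff, EReal.neg_eq_top_iff, ENNReal.log_eq_bot_iff]

theorem negLog_ofReal {r : ℝ} (hr : 0 < r) :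
    negLog (ENNReal.ofReal r) = ENNReal.ofReal (-Real.log r) := by
  rw [negLog, ENNReal.log_ofReal_of_pos hr, ← EReal.coe_neg, EReal.toENNReal_of_ne_top
    (EReal.coe_ne_top _), EReal.toReal_coe]

theorem negLog_exp_neg (f : ℝ≥0∞) : negLog (EReal.exp (-(f : EReal))) = f := by
  rw [negLog, EReal.log_exp, neg_neg, EReal.toENNReal_coe]

theorem toReal_negLog {Z : ℝ≥0∞} (hZ : Z ≤ 1) : (negLog Z).toReal = -(ENNReal.log Z).toReal := by
  rw [negLog, EReal.toReal_toENNReal, EReal.toReal_neg_eq]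
  rwa [EReal.le_neg, neg_zero, ENNReal.log_le_zero_iff]

theorem klFun_mul {w v : ℝ} (hw : w ≠ 0) :
    klFun (w * v) + w * v * -Real.log w + w = w * klFun v + 1 := by
  rcases eq_or_ne v 0 with rfl | hv
  · simp [klFun_zero, add_comm]
  · rw [klFun_apply, klFun_apply, Real.log_mul hw hv]; ring

theorem ofReal_klFun_mul {w v : ℝ≥0∞} (hw : w ≤ 1) (hv : w ≠ 0 → v ≠ ∞) :
    ENNReal.ofReal (klFun (w * v).toReal) + w * v * negLog w + w =
      w * ENNReal.ofReal (klFun v.toReal) + 1 := by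
  rcases eq_or_ne w 0 with rfl | hw0
  · simp [klFun_zero]
  lift v to ℝ≥0 using hv hw0
  lift w to ℝ≥0 using (hw.trans_lt ENNReal.one_lt_top).ne
  have hpos : 0 < (w : ℝ) := by exact_mod_cast pos_of_ne_zero hw0
  have hlog : 0 ≤ -Real.log w := neg_nonneg.2 (Real.log_nonpos w.2 (by exact_mod_cast hw))
  have hvw : 0 ≤ klFun ((w : ℝ) * v) := klFun_nonneg (by positivity)
  have hkv : 0 ≤ klFun (v : ℝ) := klFun_nonneg v.2
  simp only [ENNReal.toReal_mul, ENNReal.coe_toReal]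
  rw [← ENNReal.ofReal_coe_nnreal (p := w), ← ENNReal.ofReal_coe_nnreal (p := v),
    negLog_ofReal hpos, ← ENNReal.ofReal_one]
  rw [← ENNReal.ofReal_mul hpos.le, ← ENNReal.ofReal_mul (mul_nonneg hpos.le v.coe_nonneg),
    ← ENNReal.ofReal_mul hpos.le]
  rw [← ENNReal.ofReal_add hvw (by positivity), ← ENNReal.ofReal_add (by positivity) hpos.le,
    ← ENNReal.ofReal_add (by positivity) zero_le_one, klFun_mul hpos.ne']

theorem rnDeriv_eq_mul_rnDeriv_withDensity (μ ν : Measure Ω) [IsFiniteMeasure μ]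
    [IsFiniteMeasure ν] {w : Ω → ℝ≥0∞} (hw : Measurable w)
    [IsFiniteMeasure (ν.withDensity w)] (h : μ ≪ ν.withDensity w) :
    μ.rnDeriv ν =ᵐ[ν] fun x ↦ w x * μ.rnDeriv (ν.withDensity w) x := by
  have hv := Measure.measurable_rnDeriv μ (ν.withDensity w)
  have hμ : μ = ν.withDensity fun x ↦ w x * μ.rnDeriv (ν.withDensity w) x :=
    calc μ = (ν.withDensity w).withDensity (μ.rnDeriv (ν.withDensity w)) :=
          (Measure.withDensity_rnDeriv_eq _ _ h).symm
      _ = _ := (withDensity_mul ν hw hv).symm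
  conv_lhs => rw [hμ]
  exact Measure.rnDeriv_withDensity ν (hw.mul hv)

theorem absolutelyContinuous_withDensity_of_lintegral_negLog_ne_top
    {μ ν : Measure Ω} {w : Ω → ℝ≥0∞} (h : μ ≪ ν) (hw : Measurable w)
    (hfin : ∫⁻ x, negLog (w x) ∂μ ≠ ∞) : μ ≪ ν.withDensity w := by
  refine Measure.AbsolutelyContinuous.mk fun s hs hs0 ↦ ?_
  rw [withDensity_apply _ hs, setLIntegral_eq_zero_iff hs hw] at hs0
  have hnot : ∀ᵐ x ∂μ, x ∉ s := by
    filter_upwards [ae_lt_top (measurable_negLog.comp hw) hfin, h.ae_le hs0] with x hx hws hxs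
    exact hx.ne (negLog_eq_top_iff.2 (hws hxs))
  simpa [ae_iff] using hnot

/-- The two mass terms make the identity valid without normalizing `ν.withDensity w`. -/
theorem klDiv_add_lintegral_negLog (μ ν : Measure Ω) [IsFiniteMeasure μ]
    [IsFiniteMeasure ν] {w : Ω → ℝ≥0∞} (hw : Measurable w) (hw1 : ∀ x, w x ≤ 1) :
    klDiv μ ν + ∫⁻ x, negLog (w x) ∂μ + ∫⁻ x, w x ∂ν =
      klDiv μ (ν.withDensity w) + ν Set.univ := by
  have : IsFiniteMeasure (ν.withDensity w) :=
    isFiniteMeasure_withDensity ((lintegral_mono hw1).trans_lt (by simp)).ne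
  by_cases hac : μ ≪ ν.withDensity w
  · have hac' : μ ≪ ν := hac.trans (withDensity_absolutelyContinuous _ _)
    have hv : ∀ᵐ x ∂ν, w x ≠ 0 → μ.rnDeriv (ν.withDensity w) x < ∞ :=
      (ae_withDensity_iff hw).1 (Measure.rnDeriv_lt_top _ _)
    have hpointwise : ∀ᵐ x ∂ν, ENNReal.ofReal (klFun (μ.rnDeriv ν x).toReal)
        + μ.rnDeriv ν x * negLog (w x) + w x =
        w x * ENNReal.ofReal (klFun (μ.rnDeriv (ν.withDensity w) x).toReal) + 1 := by
      filter_upwards [rnDeriv_eq_mul_rnDeriv_withDensity μ ν hw hac, hv] with x hx hvx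
      rw [hx, ofReal_klFun_mul (hw1 x) fun h ↦ (hvx h).ne]
    have lintegral_mul_klFun := (lintegral_withDensity_eq_lintegral_mul ν hw
      (g := fun x ↦ ENNReal.ofReal (klFun (μ.rnDeriv (ν.withDensity w) x).toReal))
      (by fun_prop)).symm
    simp only [Pi.mul_apply] at lintegral_mul_klFun
    have hintegral := lintegral_congr_ae hpointwise
    rwa [lintegral_add_right _ hw, lintegral_add_right _ (by fun_prop),
      lintegral_add_right _ measurable_const, ← klDiv_eq_lintegral_klFun_of_ac hac',
      lintegral_rnDeriv_mul hac' (by fun_prop), lintegral_one,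
      lintegral_mul_klFun, ← klDiv_eq_lintegral_klFun_of_ac hac] at hintegral
  · rw [klDiv_of_not_ac hac, top_add]
    by_cases hac' : μ ≪ ν
    · have : ∫⁻ x, negLog (w x) ∂μ = ∞ := by
        contrapose! hac
        exact absolutelyContinuous_withDensity_of_lintegral_negLog_ne_top hac' hw hac
      rw [this, add_top, top_add]
    · rw [klDiv_of_not_ac hac', top_add, top_add]

/-- By the chain rule in the reversed order, the difference of the two sides is the divergence of
the output law of `P` from `η`. -/
theorem mutualInfo_le_klDiv_prod [StandardBorelSpace α] (μ : Measure α) [IsProbabilityMeasure μ]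
    (P : Kernel α β) [IsMarkovKernel P] (η : Measure β) [IsProbabilityMeasure η] :
    mutualInfo μ P ≤ klDiv (μ ⊗ₘ P) (μ.prod η) := by
  have : Nonempty α := nonempty_of_isProbabilityMeasure μ
  set ζ := (μ ⊗ₘ P).map Prod.swap
  have : IsProbabilityMeasure ζ := Measure.isProbabilityMeasure_map (by fun_prop)
  have : IsProbabilityMeasure ((μ ⊗ₘ P).map Prod.snd) :=
    Measure.isProbabilityMeasure_map (by fun_prop)
  have hfst : ζ.fst = (μ ⊗ₘ P).map Prod.snd := Measure.fst_map_swap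
  have hswap (π : Measure β) [IsProbabilityMeasure π] :
      klDiv (μ ⊗ₘ P) (μ.prod π) = klDiv ζ (π ⊗ₘ Kernel.const β μ) := by
    rw [Measure.compProd_const, ← Measure.prod_swap (μ := μ) (ν := π),
      ← klDiv_map_measurableEquiv _ _ MeasurableEquiv.prodComm]
    rfl
  rw [mutualInfo, hswap, hswap, ← ζ.disintegrate ζ.condKernel, hfst,
    klDiv_compProd_eq_add (ν := η), klDiv_compProd_eq_add, klDiv_self, zero_add]
  exact le_add_self

end Divergence

section Tilt

variable {α β : Type*} [MeasurableSpace α] [MeasurableSpace β] {w : α → β → ℝ≥0∞}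

/-- The density of the normalized tilting of `ν` by the weight `w`; it is `1` where the weight
vanishes almost everywhere. -/
noncomputable def tiltDensity (ν : Kernel α β) (w : α → β → ℝ≥0∞) (a : α) (b : β) : ℝ≥0∞ :=
  open Classical in if ∫⁻ b', w a b' ∂(ν a) = 0 then 1 else (∫⁻ b', w a b' ∂(ν a))⁻¹ * w a b

theorem measurable_tiltDensity (ν : Kernel α β) [IsSFiniteKernel ν]
    (hw : Measurable (Function.uncurry w)) : Measurable (Function.uncurry (tiltDensity ν w)) := by
  have hZ : Measurable fun p : α × β ↦ ∫⁻ b', w p.1 b' ∂(ν p.1) :=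
    hw.lintegral_kernel_prod_right.comp measurable_fst
  exact Measurable.ite (hZ (measurableSet_singleton 0)) measurable_const (hZ.inv.mul hw)

/-- The kernel with density proportional to `w` with respect to `ν`, normalized; it agrees with `ν`
where `w` vanishes almost everywhere. -/
noncomputable def tiltKernel (ν : Kernel α β) [IsSFiniteKernel ν] (w : α → β → ℝ≥0∞) :
    Kernel α β :=
  ν.withDensity (tiltDensity ν w)

variable (ν : Kernel α β) [IsMarkovKernel ν]

theorem lintegral_le_one_of_le_one (hw1 : ∀ a b, w a b ≤ 1) (a : α) : ∫⁻ b, w a b ∂(ν a) ≤ 1 :=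
  (lintegral_mono (hw1 a)).trans (by simp)

theorem tiltKernel_apply_of_lintegral_eq_zero (hw : Measurable (Function.uncurry w)) {a : α}
    (ha : ∫⁻ b, w a b ∂(ν a) = 0) : tiltKernel ν w a = ν a := by
  rw [tiltKernel, Kernel.withDensity_apply _ (measurable_tiltDensity ν hw)]
  have hdensity : tiltDensity ν w a = 1 := funext fun b ↦ if_pos ha
  rw [hdensity, withDensity_one]

theorem tiltKernel_apply (hw : Measurable (Function.uncurry w)) {a : α}
    (ha : ∫⁻ b, w a b ∂(ν a) ≠ 0) :
    tiltKernel ν w a = (∫⁻ b, w a b ∂(ν a))⁻¹ • (ν a).withDensity (w a) := by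
  rw [tiltKernel, Kernel.withDensity_apply _ (measurable_tiltDensity ν hw),
    ← withDensity_smul _ hw.of_uncurry_left]
  congr 1
  ext b
  simp [tiltDensity, ha]

theorem lintegral_smul_tiltKernel_apply (hw : Measurable (Function.uncurry w))
    (hw1 : ∀ a b, w a b ≤ 1) (a : α) :
    (∫⁻ b, w a b ∂(ν a)) • tiltKernel ν w a = (ν a).withDensity (w a) := by
  by_cases ha : ∫⁻ b, w a b ∂(ν a) = 0
  · have hwa : w a =ᵐ[ν a] 0 := (lintegral_eq_zero_iff hw.of_uncurry_left).1 ha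
    rw [ha, zero_smul, withDensity_congr_ae hwa, withDensity_zero]
  · rw [tiltKernel_apply ν hw ha, smul_smul, ENNReal.mul_inv_cancel ha
      ((lintegral_le_one_of_le_one ν hw1 a).trans_lt ENNReal.one_lt_top).ne, one_smul]

theorem isMarkovKernel_tiltKernel (hw : Measurable (Function.uncurry w))
    (hw1 : ∀ a b, w a b ≤ 1) : IsMarkovKernel (tiltKernel ν w) := by
  refine ⟨fun a ↦ ⟨?_⟩⟩
  by_cases ha : ∫⁻ b, w a b ∂(ν a) = 0
  · rw [tiltKernel_apply_of_lintegral_eq_zero ν hw ha, measure_univ]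
  · rw [tiltKernel_apply ν hw ha, Measure.smul_apply, withDensity_apply _ MeasurableSet.univ,
      setLIntegral_univ, smul_eq_mul]
    exact ENNReal.inv_mul_cancel ha
      ((lintegral_le_one_of_le_one ν hw1 a).trans_lt ENNReal.one_lt_top).ne

theorem withDensity_compProd_tiltKernel (K : Measure α) [SFinite K]
    (hw : Measurable (Function.uncurry w)) (hw1 : ∀ a b, w a b ≤ 1) :
    (K ⊗ₘ tiltKernel ν w).withDensity (fun p ↦ ∫⁻ b, w p.1 b ∂(ν p.1)) =
      (K ⊗ₘ ν).withDensity (fun p ↦ w p.1 p.2) := by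
  have := isMarkovKernel_tiltKernel ν hw hw1
  have hZ : Measurable fun p : α × β ↦ ∫⁻ b, w p.1 b ∂(ν p.1) :=
    hw.lintegral_kernel_prod_right.comp measurable_fst
  have hw' : Measurable fun p : α × β ↦ w p.1 p.2 := hw
  refine Measure.ext_of_lintegral _ fun f hf ↦ ?_
  rw [lintegral_withDensity_eq_lintegral_mul _ hw' hf,
    lintegral_withDensity_eq_lintegral_mul _ hZ hf,
    Measure.lintegral_compProd (hZ.mul hf), Measure.lintegral_compProd (hw'.mul hf)]
  refine lintegral_congr fun a ↦ ?_
  have hfa : Measurable fun b ↦ f (a, b) := by fun_prop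
  calc ∫⁻ b, (∫⁻ b', w a b' ∂(ν a)) * f (a, b) ∂(tiltKernel ν w a)
      = ∫⁻ b, f (a, b) ∂((∫⁻ b', w a b' ∂(ν a)) • tiltKernel ν w a) := by
        rw [lintegral_const_mul _ hfa, lintegral_smul_measure, smul_eq_mul]
    _ = ∫⁻ b, w a b * f (a, b) ∂(ν a) := by
        rw [lintegral_smul_tiltKernel_apply ν hw hw1,
          lintegral_withDensity_eq_lintegral_mul _ hw.of_uncurry_left hfa]
        rfl

/-- The Gibbs variational identity. Both sides are the divergence of `K ⊗ₘ q` from the same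
unnormalized measure, of density `w` with respect to `K ⊗ₘ ν` and of density the partition function
with respect to `K ⊗ₘ tiltKernel ν w`. -/
theorem klDiv_compProd_add_lintegral_negLog (K : Measure α) [IsProbabilityMeasure K]
    (q : Kernel α β) [IsMarkovKernel q] (hw : Measurable (Function.uncurry w))
    (hw1 : ∀ a b, w a b ≤ 1) :
    klDiv (K ⊗ₘ q) (K ⊗ₘ ν) + ∫⁻ p, negLog (w p.1 p.2) ∂(K ⊗ₘ q) =
      klDiv (K ⊗ₘ q) (K ⊗ₘ tiltKernel ν w) + ∫⁻ a, negLog (∫⁻ b, w a b ∂(ν a)) ∂K := by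
  have := isMarkovKernel_tiltKernel ν hw hw1
  have hZ : Measurable fun a ↦ ∫⁻ b, w a b ∂(ν a) := hw.lintegral_kernel_prod_right
  have hL : Measurable fun a ↦ negLog (∫⁻ b, w a b ∂(ν a)) := measurable_negLog.comp hZ
  have hZ1 := lintegral_le_one_of_le_one ν hw1
  have lintegral_fst {κ : Kernel α β} [IsMarkovKernel κ] {f : α → ℝ≥0∞} (hf : Measurable f) :
      ∫⁻ p, f p.1 ∂(K ⊗ₘ κ) = ∫⁻ a, f a ∂K := by
    rw [← lintegral_map hf measurable_fst, ← Measure.fst, Measure.fst_compProd]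
  have hmass : ∫⁻ a, ∫⁻ b, w a b ∂(ν a) ∂K ≠ ∞ :=
    ((lintegral_mono hZ1).trans_lt (by simp)).ne
  have hw' : Measurable fun p : α × β ↦ w p.1 p.2 := hw
  have hν := klDiv_add_lintegral_negLog (K ⊗ₘ q) (K ⊗ₘ ν) hw' fun p ↦ hw1 p.1 p.2
  have htilt := klDiv_add_lintegral_negLog (K ⊗ₘ q) (K ⊗ₘ tiltKernel ν w)
    (hZ.comp measurable_fst) fun p ↦ hZ1 p.1
  simp only [Function.comp_apply, measure_univ] at hν htilt
  rw [Measure.lintegral_compProd hw'] at hν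
  rw [lintegral_fst hZ, lintegral_fst hL] at htilt
  refine (ENNReal.add_left_inj hmass).1 (hν.trans (Eq.trans ?_ htilt.symm))
  rw [← withDensity_compProd_tiltKernel ν K hw hw1]
  rfl

end Tilt

section Rearrangement

variable {α β γ : Type*} [MeasurableSpace α] [MeasurableSpace β] [MeasurableSpace γ]

variable (α β γ) in
/-- The rearrangement `((a, b), c) ↦ ((a, c), b)`, which exchanges two letters drawn independently
given `a`. -/
def prodRightComm : (α × β) × γ ≃ᵐ (α × γ) × β where
  toFun p := ((p.1.1, p.2), p.1.2)
  invFun p := ((p.1.1, p.2), p.1.2)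
  left_inv _ := rfl
  right_inv _ := rfl
  measurable_toFun := by simp only [Equiv.coe_fn_mk]; fun_prop
  measurable_invFun := by simp only [Equiv.coe_fn_symm_mk]; fun_prop

theorem map_prodRightComm_compProd (μ : Measure α) [SFinite μ] (κ : Kernel α β)
    [IsSFiniteKernel κ] (η : Kernel α γ) [IsSFiniteKernel η] :
    ((μ ⊗ₘ κ) ⊗ₘ η.comap Prod.fst measurable_fst).map (prodRightComm α β γ) =
      (μ ⊗ₘ η) ⊗ₘ κ.comap Prod.fst measurable_fst := by
  refine Measure.ext_of_lintegral _ fun f hf ↦ ?_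
  have hf' : Measurable fun p ↦ f (prodRightComm α β γ p) :=
    hf.comp (prodRightComm α β γ).measurable
  rw [lintegral_map hf (prodRightComm α β γ).measurable, Measure.lintegral_compProd hf',
    Measure.lintegral_compProd hf'.lintegral_kernel_prod_right',
    Measure.lintegral_compProd hf, Measure.lintegral_compProd hf.lintegral_kernel_prod_right']
  refine lintegral_congr fun a ↦ ?_
  exact lintegral_lintegral_swap (μ := κ a) (ν := η a) (f := fun b c ↦ f ((a, c), b))
    (by fun_prop : Measurable fun p : β × γ ↦ f ((a, p.2), p.1)).aemeasurable

end Rearrangement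

section Laws

variable {X : ℕ → Type u} {Y : ℕ → Type v}
  [∀ i, MeasurableSpace (X i)] [∀ i, MeasurableSpace (Y i)]

instance instStandardBorelSpaceHist [∀ i, StandardBorelSpace (X i)] :
    (m : ℕ) → StandardBorelSpace (Hist X m)
  | 0 => inferInstanceAs (StandardBorelSpace PUnit)
  | m + 1 =>
    letI := instStandardBorelSpaceHist m
    inferInstanceAs (StandardBorelSpace (Hist X m × X m))

instance instIsProbabilityMeasureSourceLaw (κ : ∀ i, Kernel (Hist X i) (X i))
    [∀ i, IsMarkovKernel (κ i)] : (m : ℕ) → IsProbabilityMeasure (sourceLaw κ m)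
  | 0 => inferInstanceAs (IsProbabilityMeasure (Measure.dirac PUnit.unit))
  | m + 1 =>
    letI := instIsProbabilityMeasureSourceLaw κ m
    inferInstanceAs (IsProbabilityMeasure (sourceLaw κ m ⊗ₘ κ m : Measure (Hist X m × X m)))

instance instIsMarkovKernelCausalProduct (q : ∀ i, Kernel (Hist X (i + 1) × Hist Y i) (Y i))
    [∀ i, IsMarkovKernel (q i)] : (m : ℕ) → IsMarkovKernel (causalProduct q m)
  | 0 => inferInstanceAs (IsMarkovKernel (Kernel.const _ (Measure.dirac PUnit.unit)))
  | m + 1 =>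
    letI := instIsMarkovKernelCausalProduct q m
    inferInstanceAs (IsMarkovKernel
      ((causalProduct q m).comap Hist.init Hist.measurable_init ⊗ₖ q m :
        Kernel (Hist X (m + 1)) (Hist Y m × Y m)))

variable (X Y) in
/-- The measurable equivalence inserting a source letter before the reproduction string. -/
def insertSource (m : ℕ) : (Hist X m × Hist Y m) × X m ≃ᵐ Hist X (m + 1) × Hist Y m :=
  prodRightComm (Hist X m) (Hist Y m) (X m)

variable (X Y) in
/-- The measurable equivalence appending a letter to the reproduction string. -/
def appendOutput (m : ℕ) :
    (Hist X (m + 1) × Hist Y m) × Y m ≃ᵐ Hist X (m + 1) × Hist Y (m + 1) :=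
  (MeasurableEquiv.prodAssoc : (Hist X (m + 1) × Hist Y m) × Y m ≃ᵐ _ × (Hist Y m × Y m))

/-- The law of `(X^m, Y^{m-1})`, from which the letter `Y_m` is drawn. -/
noncomputable def preLaw (κ : ∀ i, Kernel (Hist X i) (X i))
    (q : ∀ i, Kernel (Hist X (i + 1) × Hist Y i) (Y i)) (m : ℕ) :
    Measure (Hist X (m + 1) × Hist Y m) :=
  sourceLaw κ (m + 1) ⊗ₘ (causalProduct q m).comap Hist.init Hist.measurable_init

/-- The stage kernels `ν_i(dy_i | y^{i-1})`, seen as stages of a channel that does not look at the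
source. -/
noncomputable def ignoreSource (ν : ∀ i, Kernel (Hist Y i) (Y i)) (i : ℕ) :
    Kernel (Hist X (i + 1) × Hist Y i) (Y i) :=
  (ν i).comap Prod.snd measurable_snd

instance instIsMarkovKernelIgnoreSource (ν : ∀ i, Kernel (Hist Y i) (Y i))
    [∀ i, IsMarkovKernel (ν i)] (i : ℕ) : IsMarkovKernel (ignoreSource (X := X) ν i) := by
  unfold ignoreSource; infer_instance

theorem jointLaw_succ (κ : ∀ i, Kernel (Hist X i) (X i))
    (q : ∀ i, Kernel (Hist X (i + 1) × Hist Y i) (Y i)) (m : ℕ) :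
    jointLaw κ q (m + 1) = (preLaw κ q m ⊗ₘ q m).map (appendOutput X Y m) :=
  (Measure.compProd_assoc' (μ := sourceLaw κ (m + 1))
    (κ := (causalProduct q m).comap Hist.init Hist.measurable_init) (η := q m)).symm

variable (κ : ∀ i, Kernel (Hist X i) (X i)) [∀ i, IsMarkovKernel (κ i)]
  (q q' : ∀ i, Kernel (Hist X (i + 1) × Hist Y i) (Y i)) [∀ i, IsMarkovKernel (q i)]
  [∀ i, IsMarkovKernel (q' i)] (ν : ∀ i, Kernel (Hist Y i) (Y i)) [∀ i, IsMarkovKernel (ν i)]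
  (m : ℕ)

instance instIsProbabilityMeasureJointLaw : IsProbabilityMeasure (jointLaw κ q m) := by
  unfold jointLaw; infer_instance

instance instIsProbabilityMeasurePreLaw : IsProbabilityMeasure (preLaw κ q m) := by
  unfold preLaw; infer_instance

theorem preLaw_eq_map : preLaw κ q m =
    (jointLaw κ q m ⊗ₘ (κ m).comap Prod.fst measurable_fst).map (insertSource X Y m) :=
  (map_prodRightComm_compProd (sourceLaw κ m) (causalProduct q m) (κ m)).symm

theorem lintegral_preLaw {f : Hist X (m + 1) × Hist Y m → ℝ≥0∞} (hf : Measurable f) :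
    ∫⁻ z, f z ∂(preLaw κ q m) =
      ∫⁻ h, ∫⁻ x, f (h.1.snoc x, h.2) ∂(κ m h.1) ∂(jointLaw κ q m) := by
  rw [preLaw_eq_map, lintegral_map hf (insertSource X Y m).measurable]
  exact Measure.lintegral_compProd (hf.comp (insertSource X Y m).measurable)

theorem measurable_lintegral_snoc {f : Hist X (m + 1) × Hist Y m → ℝ≥0∞} (hf : Measurable f) :
    Measurable fun h : Hist X m × Hist Y m ↦ ∫⁻ x, f (h.1.snoc x, h.2) ∂(κ m h.1) :=
  (hf.comp (insertSource X Y m).measurable).lintegral_kernel_prod_right'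
    (κ := (κ m).comap Prod.fst measurable_fst)

theorem map_init_jointLaw_succ :
    (jointLaw κ q (m + 1)).map (Prod.map Hist.init Hist.init) = jointLaw κ q m := by
  have hinit : Measurable (Prod.map Hist.init id : Hist X (m + 1) × Hist Y m → _) :=
    Hist.measurable_init.prodMap measurable_id
  calc (jointLaw κ q (m + 1)).map (Prod.map Hist.init Hist.init)
      = (preLaw κ q m ⊗ₘ q m).fst.map (Prod.map Hist.init id) := by
        rw [jointLaw_succ, Measure.map_map (Hist.measurable_init.prodMap Hist.measurable_init)
          (appendOutput X Y m).measurable, Measure.fst, Measure.map_map hinit measurable_fst]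
        rfl
    _ = (jointLaw κ q m ⊗ₘ (κ m).comap Prod.fst measurable_fst).fst := by
        rw [Measure.fst_compProd, preLaw_eq_map,
          Measure.map_map hinit (insertSource X Y m).measurable]
        rfl
    _ = jointLaw κ q m := Measure.fst_compProd _ _

theorem klDiv_jointLaw_eq_sum : klDiv (jointLaw κ q m) (jointLaw κ q' m) =
    ∑ i ∈ Finset.range m, klDiv (preLaw κ q i ⊗ₘ q i) (preLaw κ q i ⊗ₘ q' i) := by
  induction m with
  | zero => exact klDiv_self (jointLaw κ q 0)
  | succ m ih =>
    rw [Finset.sum_range_succ, ← ih, jointLaw_succ, jointLaw_succ, klDiv_map_measurableEquiv,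
      klDiv_compProd_eq_add]
    congr 1
    rw [preLaw_eq_map, preLaw_eq_map, klDiv_map_measurableEquiv, klDiv_compProd_left]

theorem causalProduct_ignoreSource :
    causalProduct (X := X) (ignoreSource ν) m = Kernel.const _ (sourceLaw ν m) := by
  induction m with
  | zero => rfl
  | succ m ih =>
    ext x : 1
    rw [causalProduct, ih]
    exact Kernel.compProd_apply_eq_compProd_sectR _ _ x

theorem jointLaw_ignoreSource :
    jointLaw κ (ignoreSource ν) m = (sourceLaw κ m).prod (sourceLaw ν m) := by
  rw [jointLaw, causalProduct_ignoreSource, Measure.compProd_const]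

variable {κ ν m} in
theorem outputLaw_eq_sourceLaw {q : ∀ i, Kernel (Hist X (i + 1) × Hist Y i) (Y i)} {n : ℕ}
    (hν : IsOutputConditional κ q n ν) (hm : m ≤ n + 1) : outputLaw κ q m = sourceLaw ν m := by
  induction m with
  | zero =>
    have hprod : jointLaw κ q 0 = (sourceLaw κ 0).prod (sourceLaw ν 0) :=
      jointLaw_ignoreSource κ ν 0
    rw [outputLaw, hprod]
    exact Measure.snd_prod
  | succ m ih => rw [hν m (by omega), ih (by omega)]; rfl

theorem measurable_distortion {ρ : ∀ i, Hist X (i + 1) → Hist Y (i + 1) → ℝ≥0}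
    (hρ : ∀ i, Measurable (Function.uncurry (ρ i))) :
    Measurable fun z : Hist X m × Hist Y m ↦ distortion ρ m z.1 z.2 := by
  induction m with
  | zero => exact measurable_const
  | succ m ih => exact (ih.comp (Hist.measurable_init.prodMap Hist.measurable_init)).add (hρ m)

theorem lintegral_distortion_eq_sum {ρ : ∀ i, Hist X (i + 1) → Hist Y (i + 1) → ℝ≥0}
    (hρ : ∀ i, Measurable (Function.uncurry (ρ i))) :
    ∫⁻ z, (distortion ρ m z.1 z.2 : ℝ≥0∞) ∂(jointLaw κ q m) =
      ∑ i ∈ Finset.range m, ∫⁻ w, (ρ i w.1.1 (w.1.2.snoc w.2) : ℝ≥0∞) ∂(preLaw κ q i ⊗ₘ q i) := by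
  induction m with
  | zero => simp [distortion]
  | succ m ih =>
    have hinit : Measurable (Prod.map Hist.init Hist.init :
        Hist X (m + 1) × Hist Y (m + 1) → _) :=
      Hist.measurable_init.prodMap Hist.measurable_init
    have hm := (measurable_distortion m hρ).coe_nnreal_ennreal
    rw [Finset.sum_range_succ, ← ih, ← map_init_jointLaw_succ κ q m, lintegral_map hm hinit]
    simp only [distortion, ENNReal.coe_add]
    rw [lintegral_add_left (f := fun z : Hist X (m + 1) × Hist Y (m + 1) ↦
      (distortion ρ m z.1.init z.2.init : ℝ≥0∞)) (hm.comp hinit)]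
    congr 1
    rw [jointLaw_succ]
    exact lintegral_map (hρ m).coe_nnreal_ennreal (appendOutput X Y m).measurable

end Laws

section Recursion

variable {X : ℕ → Type u} {Y : ℕ → Type v}
  [∀ i, MeasurableSpace (X i)] [∀ i, MeasurableSpace (Y i)]

theorem gibbsWeight_eq_exp_neg {s : ℝ} (hs : s ≤ 0) (r : ℝ≥0) (g : ℝ≥0∞) :
    gibbsWeight s r g = EReal.exp (-((ENNReal.ofReal (-s) * r + g : ℝ≥0∞) : EReal)) := by
  have hsr : ((ENNReal.ofReal (-s) * r : ℝ≥0∞) : EReal) = ((-(s * r) : ℝ) : EReal) := by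
    rw [← ENNReal.ofReal_coe_nnreal, ← ENNReal.ofReal_mul (by linarith),
      EReal.coe_ennreal_ofReal, neg_mul,
      max_eq_left (by simpa using mul_nonpos_of_nonpos_of_nonneg hs r.2)]
  rw [gibbsWeight, EReal.coe_ennreal_add, hsr, EReal.neg_add (.inl (EReal.coe_ne_bot _))
    (.inl (EReal.coe_ne_top _)), ← EReal.coe_neg, neg_neg, sub_eq_add_neg]

theorem measurable_gibbsWeight {α : Type*} [MeasurableSpace α] {s : ℝ} (hs : s ≤ 0)
    {r : α → ℝ≥0} {g : α → ℝ≥0∞} (hr : Measurable r) (hg : Measurable g) :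
    Measurable fun a ↦ gibbsWeight s (r a) (g a) := by
  simp_rw [gibbsWeight_eq_exp_neg hs]
  fun_prop

variable {κ : ∀ i, Kernel (Hist X i) (X i)} {ρ : ∀ i, Hist X (i + 1) → Hist Y (i + 1) → ℝ≥0}
  {ν : ∀ i, Kernel (Hist Y i) (Y i)} {s : ℝ}

theorem stageWeight_le_one (hs : s ≤ 0) (n i : ℕ) (x : Hist X (i + 1)) (y : Hist Y i) (y' : Y i) :
    stageWeight κ ρ ν s n i x y y' ≤ 1 := by
  rw [stageWeight, gibbsWeight_eq_exp_neg hs, EReal.exp_le_one_iff, EReal.neg_le_zero]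
  exact EReal.coe_ennreal_nonneg _

theorem negLog_stageWeight (hs : s ≤ 0) (n i : ℕ) (x : Hist X (i + 1)) (y : Hist Y i) (y' : Y i) :
    negLog (stageWeight κ ρ ν s n i x y y') =
      ENNReal.ofReal (-s) * ρ i x (y.snoc y') + g κ ρ ν s n i x (y.snoc y') := by
  rw [stageWeight, gibbsWeight_eq_exp_neg hs, negLog_exp_neg]

theorem g_self (n : ℕ) (x : Hist X (n + 1)) (y : Hist Y (n + 1)) : g κ ρ ν s n n x y = 0 := by
  rw [g, Nat.sub_self, gAux]

theorem g_eq_lintegral_negLog {n i : ℕ} (hi : i < n) (x : Hist X (i + 1)) (y : Hist Y (i + 1)) :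
    g κ ρ ν s n i x y =
      ∫⁻ x', negLog (partitionFn κ ρ ν s n (i + 1) (x.snoc x') y) ∂(κ (i + 1) x) := by
  have hsub : n - i = n - (i + 1) + 1 := by omega
  rw [g, hsub, gAux]
  rfl

variable (κ ρ ν s) in
/-- The mean of `-log Z_i` under the causal channel `q`. -/
noncomputable def stageFreeEnergy (n : ℕ) (q : ∀ i, Kernel (Hist X (i + 1) × Hist Y i) (Y i))
    (i : ℕ) : ℝ≥0∞ :=
  ∫⁻ w, negLog (partitionFn κ ρ ν s n i w.1 w.2) ∂(preLaw κ q i)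

variable (κ ρ ν s) in
/-- The mean of `g_{i,n}` under the causal channel `q`; it accounts for the stages after `i`. -/
noncomputable def costToGo (n : ℕ) (q : ∀ i, Kernel (Hist X (i + 1) × Hist Y i) (Y i)) (i : ℕ) :
    ℝ≥0∞ :=
  ∫⁻ p, g κ ρ ν s n i p.1.1 (p.1.2.snoc p.2) ∂(preLaw κ q i ⊗ₘ q i)

theorem costToGo_self (q : ∀ i, Kernel (Hist X (i + 1) × Hist Y i) (Y i)) (n : ℕ) :
    costToGo κ ρ ν s n q n = 0 := by
  simp only [costToGo, g_self, lintegral_zero]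

theorem partitionFn_le_one [∀ i, IsMarkovKernel (ν i)] (hs : s ≤ 0) (n i : ℕ)
    (x : Hist X (i + 1)) (y : Hist Y i) : partitionFn κ ρ ν s n i x y ≤ 1 :=
  (lintegral_mono fun y' ↦ stageWeight_le_one hs n i x y y').trans (by simp)

variable [∀ i, IsMarkovKernel (κ i)] [∀ i, IsMarkovKernel (ν i)]

theorem measurable_gAux (hρ : ∀ i, Measurable (Function.uncurry (ρ i))) (hs : s ≤ 0) (k i : ℕ) :
    Measurable (Function.uncurry (gAux κ ρ ν s k i)) := by
  induction k generalizing i with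
  | zero => exact measurable_const
  | succ k ih =>
    have hweight : Measurable fun p : (Hist X (i + 2) × Hist Y (i + 1)) × Y (i + 1) ↦
        gibbsWeight s (ρ (i + 1) p.1.1 (p.1.2.snoc p.2))
          (gAux κ ρ ν s k (i + 1) p.1.1 (p.1.2.snoc p.2)) :=
      measurable_gibbsWeight hs ((hρ (i + 1)).comp (appendOutput X Y (i + 1)).measurable)
        ((ih (i + 1)).comp (appendOutput X Y (i + 1)).measurable)
    exact measurable_lintegral_snoc κ (i + 1) (measurable_negLog.comp
      (hweight.lintegral_kernel_prod_right' (κ := ignoreSource ν (i + 1))))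

theorem measurable_g (hρ : ∀ i, Measurable (Function.uncurry (ρ i))) (hs : s ≤ 0) (n i : ℕ) :
    Measurable fun p : (Hist X (i + 1) × Hist Y i) × Y i ↦
      g κ ρ ν s n i p.1.1 (p.1.2.snoc p.2) :=
  (measurable_gAux hρ hs (n - i) i).comp (appendOutput X Y i).measurable

theorem integral_toReal_g (hρ : ∀ i, Measurable (Function.uncurry (ρ i))) (hs : s ≤ 0) {n i : ℕ}
    {x : Hist X (i + 1)} {y : Hist Y i} {μ : Measure (Y i)}
    (hfin : ∫⁻ y', g κ ρ ν s n i x (y.snoc y') ∂μ ≠ ∞) :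
    ∫ y', (g κ ρ ν s n i x (y.snoc y')).toReal ∂μ =
      (∫⁻ y', g κ ρ ν s n i x (y.snoc y') ∂μ).toReal :=
  have hg : Measurable fun y' ↦ g κ ρ ν s n i x (y.snoc y') :=
    (measurable_g hρ hs n i).comp (measurable_prodMk_left (x := (x, y)))
  integral_toReal hg.aemeasurable (ae_lt_top hg hfin)

theorem measurable_stageWeight (hρ : ∀ i, Measurable (Function.uncurry (ρ i))) (hs : s ≤ 0)
    (n i : ℕ) : Measurable (Function.uncurry
      fun w : Hist X (i + 1) × Hist Y i ↦ stageWeight κ ρ ν s n i w.1 w.2) :=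
  measurable_gibbsWeight hs ((hρ i).comp (appendOutput X Y i).measurable) (measurable_g hρ hs n i)

theorem measurable_negLog_partitionFn (hρ : ∀ i, Measurable (Function.uncurry (ρ i)))
    (hs : s ≤ 0) (n i : ℕ) : Measurable fun w : Hist X (i + 1) × Hist Y i ↦
      negLog (partitionFn κ ρ ν s n i w.1 w.2) :=
  measurable_negLog.comp
    ((measurable_stageWeight hρ hs n i).lintegral_kernel_prod_right' (κ := ignoreSource ν i))

variable (κ ρ ν s) in
/-- The Gibbs kernel `e^{s ρ_i - g_{i,n}} ν_i(dy_i | y^{i-1}) / Z_i`, equal to `ν_i` where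
`Z_i = 0`. -/
noncomputable def gibbsKernel (n i : ℕ) : Kernel (Hist X (i + 1) × Hist Y i) (Y i) :=
  tiltKernel (ignoreSource ν i) (fun w ↦ stageWeight κ ρ ν s n i w.1 w.2)

theorem isMarkovKernel_gibbsKernel (hρ : ∀ i, Measurable (Function.uncurry (ρ i))) (hs : s ≤ 0)
    (n i : ℕ) : IsMarkovKernel (gibbsKernel κ ρ ν s n i) :=
  isMarkovKernel_tiltKernel _ (measurable_stageWeight hρ hs n i)
    fun w y ↦ stageWeight_le_one hs n i w.1 w.2 y

theorem gibbsKernel_apply (hρ : ∀ i, Measurable (Function.uncurry (ρ i))) (hs : s ≤ 0)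
    (n i : ℕ) {w : Hist X (i + 1) × Hist Y i} (hw : partitionFn κ ρ ν s n i w.1 w.2 ≠ 0) :
    gibbsKernel κ ρ ν s n i w = (partitionFn κ ρ ν s n i w.1 w.2)⁻¹ •
      (ν i w.2).withDensity (stageWeight κ ρ ν s n i w.1 w.2) :=
  tiltKernel_apply (ignoreSource ν i) (measurable_stageWeight hρ hs n i) hw

variable (κ ρ ν s) in
/-- The contribution of stage `i` to the Lagrangian: the conditional divergence of `q i` from `ν i`
plus `-s` times the mean of `ρ i`. -/
noncomputable def stageCost (q : ∀ i, Kernel (Hist X (i + 1) × Hist Y i) (Y i)) (i : ℕ) : ℝ≥0∞ :=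
  klDiv (preLaw κ q i ⊗ₘ q i) (preLaw κ q i ⊗ₘ ignoreSource ν i) +
    ENNReal.ofReal (-s) * ∫⁻ p, (ρ i p.1.1 (p.1.2.snoc p.2) : ℝ≥0∞) ∂(preLaw κ q i ⊗ₘ q i)

variable (κ ρ ν s) in
/-- The conditional divergence of `q i` from the Gibbs kernel, by which stage `i` of the causal
channel `q` fails to be optimal. -/
noncomputable def gibbsGap (n : ℕ) (q : ∀ i, Kernel (Hist X (i + 1) × Hist Y i) (Y i)) (i : ℕ) :
    ℝ≥0∞ :=
  klDiv (preLaw κ q i ⊗ₘ q i) (preLaw κ q i ⊗ₘ gibbsKernel κ ρ ν s n i)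

theorem gibbsGap_gibbsKernel (hρ : ∀ i, Measurable (Function.uncurry (ρ i))) (hs : s ≤ 0)
    (n i : ℕ) : gibbsGap κ ρ ν s n (gibbsKernel κ ρ ν s n) i = 0 := by
  have := isMarkovKernel_gibbsKernel (κ := κ) (ν := ν) hρ hs n
  exact klDiv_self _

variable (q : ∀ i, Kernel (Hist X (i + 1) × Hist Y i) (Y i)) [∀ i, IsMarkovKernel (q i)]

theorem stageCost_add_costToGo (hρ : ∀ i, Measurable (Function.uncurry (ρ i))) (hs : s ≤ 0)
    (n i : ℕ) : stageCost κ ρ ν s q i + costToGo κ ρ ν s n q i =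
      gibbsGap κ ρ ν s n q i + stageFreeEnergy κ ρ ν s n q i := by
  have hdist : Measurable fun p : (Hist X (i + 1) × Hist Y i) × Y i ↦
      (ρ i p.1.1 (p.1.2.snoc p.2) : ℝ≥0∞) :=
    ((hρ i).comp (appendOutput X Y i).measurable).coe_nnreal_ennreal
  have hgibbs := klDiv_compProd_add_lintegral_negLog (ignoreSource ν i) (preLaw κ q i) (q i)
    (measurable_stageWeight (κ := κ) (ν := ν) hρ hs n i)
    fun w y ↦ stageWeight_le_one hs n i w.1 w.2 y
  simp only [negLog_stageWeight hs] at hgibbs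
  rwa [lintegral_add_left (hdist.const_mul _), lintegral_const_mul _ hdist, ← add_assoc] at hgibbs

theorem costToGo_eq_stageFreeEnergy_succ (hρ : ∀ i, Measurable (Function.uncurry (ρ i)))
    (hs : s ≤ 0) {n i : ℕ} (hi : i < n) :
    costToGo κ ρ ν s n q i = stageFreeEnergy κ ρ ν s n q (i + 1) := by
  have hnegLog := measurable_negLog_partitionFn (κ := κ) (ν := ν) hρ hs n (i + 1)
  rw [stageFreeEnergy, lintegral_preLaw κ q (i + 1) hnegLog, jointLaw_succ,
    lintegral_map (measurable_lintegral_snoc κ (i + 1) hnegLog) (appendOutput X Y i).measurable]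
  exact lintegral_congr fun p ↦ g_eq_lintegral_negLog hi _ _

theorem sum_Ico_stageCost (hρ : ∀ i, Measurable (Function.uncurry (ρ i))) (hs : s ≤ 0)
    {n i : ℕ} (hi : i ≤ n) : ∑ j ∈ Finset.Ico i (n + 1), stageCost κ ρ ν s q j =
      ∑ j ∈ Finset.Ico i (n + 1), gibbsGap κ ρ ν s n q j + stageFreeEnergy κ ρ ν s n q i := by
  induction hi using Nat.decreasingInduction with
  | self => simpa [costToGo_self] using stageCost_add_costToGo (κ := κ) (ν := ν) q hρ hs n n
  | of_succ i hi ih =>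
    rw [Finset.sum_eq_sum_Ico_succ_bot (by omega), ih,
      Finset.sum_eq_sum_Ico_succ_bot (a := i) (by omega),
      ← costToGo_eq_stageFreeEnergy_succ q hρ hs hi, add_left_comm,
      stageCost_add_costToGo q hρ hs n i]
    ring

theorem sum_range_stageCost (hρ : ∀ i, Measurable (Function.uncurry (ρ i))) (hs : s ≤ 0)
    (n : ℕ) : ∑ i ∈ Finset.range (n + 1), stageCost κ ρ ν s q i =
      ∑ i ∈ Finset.range (n + 1), gibbsGap κ ρ ν s n q i + stageFreeEnergy κ ρ ν s n q 0 := by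
  rw [Finset.range_eq_Ico]
  exact sum_Ico_stageCost q hρ hs (Nat.zero_le n)

theorem sum_range_stageCost_eq_klDiv_add (hρ : ∀ i, Measurable (Function.uncurry (ρ i))) (n : ℕ) :
    ∑ i ∈ Finset.range (n + 1), stageCost κ ρ ν s q i =
      klDiv (jointLaw κ q (n + 1)) ((sourceLaw κ (n + 1)).prod (sourceLaw ν (n + 1))) +
        ENNReal.ofReal (-s) * avgDistortion κ ρ n (causalProduct q (n + 1)) := by
  rw [← jointLaw_ignoreSource, klDiv_jointLaw_eq_sum, avgDistortion, ← jointLaw,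
    lintegral_distortion_eq_sum κ q (n + 1) hρ, Finset.mul_sum, ← Finset.sum_add_distrib]
  rfl

end Recursion

section SupportingLine

theorem map_prod_eq_mul_add_mul (f : ℝ × ℝ →L[ℝ] ℝ) (x y : ℝ) :
    f (x, y) = f (1, 0) * x + f (0, 1) * y := by
  have hxy : (x, y) = x • ((1, 0) : ℝ × ℝ) + y • ((0, 1) : ℝ × ℝ) := by simp
  rw [hxy, map_add, map_smul, map_smul, smul_eq_mul, smul_eq_mul, mul_comm, mul_comm y]

theorem exists_neg_slope_supporting_line {S : Set (ℝ × ℝ)} (hS : Convex ℝ S) {D r : ℝ}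
    (hr : ∀ p ∈ S, p.1 ≤ D → r ≤ p.2) (hleft : ∃ p ∈ S, p.1 < D) (hbelow : ∃ p ∈ S, p.2 < r) :
    ∃ t < 0, ∀ p ∈ S, r + t * (p.1 - D) ≤ p.2 := by
  have hdisj : Disjoint (Set.Iio D ×ˢ Set.Iio r) S :=
    Set.disjoint_left.2 fun p hp hpS ↦ (hr p hpS (le_of_lt hp.1)).not_gt hp.2
  obtain ⟨f, u, hfu, hSu⟩ := geometric_hahn_banach_open ((convex_Iio D).prod (convex_Iio r))
    (isOpen_Iio.prod isOpen_Iio) hS hdisj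
  set a := f (1, 0)
  set b := f (0, 1)
  have hf (x y : ℝ) : f (x, y) = a * x + b * y := map_prod_eq_mul_add_mul f x y
  have hseparated {x y : ℝ} (hx : x < D) (hy : y < r) {p} (hp : p ∈ S) :
      a * x + b * y < a * p.1 + b * p.2 := by
    rw [← hf, ← hf]
    exact (hfu (x, y) ⟨hx, hy⟩).trans_le (hSu p hp)
  have ha : 0 < a := by
    obtain ⟨p, hp, hpr⟩ := hbelow
    have hDp : D < p.1 := lt_of_not_ge fun h ↦ (hr p hp h).not_gt hpr
    have := hseparated (sub_one_lt D) hpr hp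
    exact pos_of_mul_pos_left (b := p.1 - (D - 1)) (by linarith) (by linarith)
  have hb : 0 < b := by
    obtain ⟨p, hp, hpD⟩ := hleft
    have hrp : r ≤ p.2 := hr p hp hpD.le
    have := hseparated hpD (sub_one_lt r) hp
    exact pos_of_mul_pos_left (b := p.2 - (r - 1)) (by linarith) (by linarith)
  have hcorner : f (D, r) ≤ u := by
    refine closure_minimal (fun p hp ↦ (hfu p hp).le) (isClosed_Iic.preimage f.continuous) ?_
    rw [closure_prod_eq, closure_Iio, closure_Iio]
    exact ⟨Set.self_mem_Iic, Set.self_mem_Iic⟩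
  refine ⟨-(a / b), neg_lt_zero.2 (div_pos ha hb), fun p hp ↦ ?_⟩
  have hsupport : a * D + b * r ≤ a * p.1 + b * p.2 := by
    rw [← hf, ← hf]
    exact hcorner.trans (hSu p hp)
  refine le_of_mul_le_mul_left ?_ hb
  calc b * (r + -(a / b) * (p.1 - D)) = a * D + b * r - a * p.1 := by field_simp; ring
    _ ≤ b * p.2 := by linarith

end SupportingLine

section Multiplier

variable {X : ℕ → Type u} {Y : ℕ → Type v}
  [∀ i, MeasurableSpace (X i)] [∀ i, MeasurableSpace (Y i)]

theorem exists_jointLaw_eq_add [∀ i, StandardBorelSpace (Y i)]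
    (κ : ∀ i, Kernel (Hist X i) (X i)) [∀ i, IsMarkovKernel (κ i)]
    (q₁ q₂ : ∀ i, Kernel (Hist X (i + 1) × Hist Y i) (Y i)) [∀ i, IsMarkovKernel (q₁ i)]
    [∀ i, IsMarkovKernel (q₂ i)] {a b : ℝ≥0} (hab : a + b = 1) :
    ∃ q : ∀ i, Kernel (Hist X (i + 1) × Hist Y i) (Y i), (∀ i, IsMarkovKernel (q i)) ∧
      ∀ m, jointLaw κ q m = a • jointLaw κ q₁ m + b • jointLaw κ q₂ m := by
  have hY (i : ℕ) : Nonempty (Y i) := by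
    obtain ⟨w⟩ := nonempty_of_isProbabilityMeasure (preLaw κ q₁ i)
    exact nonempty_of_isProbabilityMeasure (q₁ i w)
  let mixture (i : ℕ) : Measure ((Hist X (i + 1) × Hist Y i) × Y i) :=
    a • (preLaw κ q₁ i ⊗ₘ q₁ i) + b • (preLaw κ q₂ i ⊗ₘ q₂ i)
  have fst_mixture (i : ℕ) : (mixture i).fst = a • preLaw κ q₁ i + b • preLaw κ q₂ i := by
    rw [Measure.fst, Measure.map_add _ _ measurable_fst, Measure.map_smul, Measure.map_smul,
      ← Measure.fst, ← Measure.fst, Measure.fst_compProd, Measure.fst_compProd]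
  refine ⟨fun i ↦ (mixture i).condKernel, fun i ↦ inferInstance, fun m ↦ ?_⟩
  induction m with
  | zero =>
    change jointLaw κ q₁ 0 = a • jointLaw κ q₁ 0 + b • jointLaw κ q₁ 0
    rw [← add_smul, hab, one_smul]
  | succ m ih =>
    have hpre : preLaw κ (fun i ↦ (mixture i).condKernel) m = (mixture m).fst := by
      rw [fst_mixture]
      refine Measure.ext_of_lintegral _ fun f hf ↦ ?_
      simp only [lintegral_preLaw κ _ m hf, ih, lintegral_add_measure, lintegral_smul_measure]
    rw [jointLaw_succ, jointLaw_succ, jointLaw_succ, hpre, (mixture m).disintegrate,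
      Measure.map_add _ _ (appendOutput X Y m).measurable, Measure.map_smul, Measure.map_smul]

theorem compProd_eq_jointLaw {κ : ∀ i, Kernel (Hist X i) (X i)} {m : ℕ}
    {P : Kernel (Hist X m) (Hist Y m)} [IsMarkovKernel P]
    {q : ∀ i, Kernel (Hist X (i + 1) × Hist Y i) (Y i)} [∀ i, IsMarkovKernel (q i)]
    (h : ∀ᵐ x ∂(sourceLaw κ m), P x = causalProduct q m x) :
    sourceLaw κ m ⊗ₘ P = jointLaw κ q m :=
  Measure.compProd_congr h

theorem causalProduct_mem_causalKernels (κ : ∀ i, Kernel (Hist X i) (X i))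
    (q : ∀ i, Kernel (Hist X (i + 1) × Hist Y i) (Y i)) [hq : ∀ i, IsMarkovKernel (q i)] (n : ℕ) :
    causalProduct q (n + 1) ∈ causalKernels κ n :=
  ⟨inferInstance, q, hq, ae_of_all _ fun _ ↦ rfl⟩

theorem exists_mem_causalKernels_avgDistortion_eq_add_mutualInfo_le
    [∀ i, StandardBorelSpace (Y i)]
    (κ : ∀ i, Kernel (Hist X i) (X i)) [∀ i, IsMarkovKernel (κ i)]
    (ρ : ∀ i, Hist X (i + 1) → Hist Y (i + 1) → ℝ≥0) {n : ℕ}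
    {P₁ P₂ : Kernel (Hist X (n + 1)) (Hist Y (n + 1))} (h₁ : P₁ ∈ causalKernels κ n)
    (h₂ : P₂ ∈ causalKernels κ n) {a b : ℝ≥0} (hab : a + b = 1) :
    ∃ P ∈ causalKernels κ n,
      avgDistortion κ ρ n P = a * avgDistortion κ ρ n P₁ + b * avgDistortion κ ρ n P₂ ∧
      mutualInfo (sourceLaw κ (n + 1)) P ≤
        a * mutualInfo (sourceLaw κ (n + 1)) P₁ + b * mutualInfo (sourceLaw κ (n + 1)) P₂ := by
  obtain ⟨hP₁, q₁, hq₁, hPq₁⟩ := h₁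
  obtain ⟨hP₂, q₂, hq₂, hPq₂⟩ := h₂
  obtain ⟨q, hq, hmix⟩ := exists_jointLaw_eq_add κ q₁ q₂ hab
  have hlaw : sourceLaw κ (n + 1) ⊗ₘ causalProduct q (n + 1) =
      a • (sourceLaw κ (n + 1) ⊗ₘ P₁) + b • (sourceLaw κ (n + 1) ⊗ₘ P₂) := by
    rw [compProd_eq_jointLaw hPq₁, compProd_eq_jointLaw hPq₂, ← hmix, jointLaw]
  refine ⟨causalProduct q (n + 1), causalProduct_mem_causalKernels κ q n, ?_, ?_⟩
  · simp only [avgDistortion, hlaw, lintegral_add_measure, lintegral_smul_measure]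
    rfl
  · simp only [mutualInfo, hlaw]
    rw [Measure.map_add _ _ measurable_snd, Measure.map_smul, Measure.map_smul, Measure.prod_add,
      Measure.prod_smul_right, Measure.prod_smul_right]
    refine (klDiv_add_le _ _ _ _).trans ?_
    rw [klDiv_smul_same, klDiv_smul_same]

/-- The Lagrangian `I(P) - s ℓ(P)`, an element of `[0, ∞]` for `s ≤ 0`. -/
noncomputable def lagrangian (κ : ∀ i, Kernel (Hist X i) (X i))
    (ρ : ∀ i, Hist X (i + 1) → Hist Y (i + 1) → ℝ≥0) (n : ℕ) (s : ℝ)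
    (P : Kernel (Hist X (n + 1)) (Hist Y (n + 1))) : ℝ≥0∞ :=
  mutualInfo (sourceLaw κ (n + 1)) P + ENNReal.ofReal (-s) * avgDistortion κ ρ n P

variable {κ : ∀ i, Kernel (Hist X i) (X i)} {ρ : ∀ i, Hist X (i + 1) → Hist Y (i + 1) → ℝ≥0}
  {n : ℕ} {D : ℝ≥0} {s : ℝ}

theorem coe_mutualInfo_sub_mul (hs : s ≤ 0) (P : Kernel (Hist X (n + 1)) (Hist Y (n + 1))) :
    (mutualInfo (sourceLaw κ (n + 1)) P : EReal) -
        (s : EReal) * ((avgDistortion κ ρ n P : EReal) - ((D : ℝ) : EReal)) =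
      (lagrangian κ ρ n s P : EReal) - ((ENNReal.ofReal (-s) * D : ℝ≥0∞) : EReal) := by
  have hs' : (0 : EReal) ≤ ((-s : ℝ) : EReal) := EReal.coe_nonneg.2 (neg_nonneg.2 hs)
  have hmul (x : ℝ≥0∞) :
      ((ENNReal.ofReal (-s) * x : ℝ≥0∞) : EReal) = ((-s : ℝ) : EReal) * x := by
    rw [EReal.coe_ennreal_mul, EReal.coe_ennreal_ofReal, max_eq_left (neg_nonneg.2 hs)]
  have hD : (((D : ℝ≥0∞) : EReal)) = ((D : ℝ) : EReal) := rfl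
  rw [lagrangian, EReal.coe_ennreal_add, hmul, hmul, hD, add_sub_assoc,
    ← EReal.mul_sub_of_nonneg_of_ne_top hs' (EReal.coe_ne_top _), EReal.coe_neg,
    EReal.neg_mul, sub_eq_add_neg]

theorem isLagrangeMultiplier_iff : IsLagrangeMultiplier κ ρ n D s ↔
    s ≤ 0 ∧ ∀ P ∈ causalKernels κ n,
      causalRDF κ ρ n D + ENNReal.ofReal (-s) * D ≤ lagrangian κ ρ n s P := by
  refine and_congr_right fun hs ↦ ?_
  simp only [coe_mutualInfo_sub_mul hs]
  set c : ℝ≥0∞ := ENNReal.ofReal (-s) * D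
  have hc : (c : EReal) ≠ ⊤ := by
    rw [Ne, EReal.coe_ennreal_eq_top_iff]
    exact ENNReal.mul_ne_top ENNReal.ofReal_ne_top ENNReal.coe_ne_top
  have hle_iff : (causalRDF κ ρ n D : EReal) ≤
        (⨅ P ∈ causalKernels κ n, ((lagrangian κ ρ n s P : EReal) - c)) ↔
      ∀ P ∈ causalKernels κ n, causalRDF κ ρ n D + c ≤ lagrangian κ ρ n s P := by
    simp only [le_iInf_iff, EReal.le_sub_iff_add_le (.inl (EReal.coe_ennreal_ne_bot c)) (.inl hc)]
    norm_cast
  have hge : (⨅ P ∈ causalKernels κ n, ((lagrangian κ ρ n s P : EReal) - c)) ≤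
      causalRDF κ ρ n D := by
    set x : EReal := ⨅ P ∈ causalKernels κ n, ((lagrangian κ ρ n s P : EReal) - c)
    have hx : x ≤ x.toENNReal := (le_max_right 0 x).trans_eq EReal.coe_toENNReal_eq_max.symm
    refine hx.trans (EReal.coe_ennreal_le_coe_ennreal_iff.2 (le_iInf₂ fun P hP ↦ ?_))
    rw [← EReal.toENNReal_coe (x := mutualInfo (sourceLaw κ (n + 1)) P)]
    refine EReal.toENNReal_le_toENNReal ((iInf₂_le P hP.1).trans (EReal.sub_le_of_le_add ?_))
    rw [← EReal.coe_ennreal_add, EReal.coe_ennreal_le_coe_ennreal_iff, lagrangian]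
    gcongr
    exact mul_le_mul_right hP.2 _
  rw [← hle_iff]
  exact ⟨Eq.le, fun h ↦ h.antisymm hge⟩

theorem lagrangian_eq_causalRDF_add {P : Kernel (Hist X (n + 1)) (Hist Y (n + 1))}
    (hP : P ∈ fidelitySet κ ρ n D)
    (hopt : mutualInfo (sourceLaw κ (n + 1)) P = causalRDF κ ρ n D)
    (hL : IsLagrangeMultiplier κ ρ n D s) :
    lagrangian κ ρ n s P = causalRDF κ ρ n D + ENNReal.ofReal (-s) * D := by
  refine le_antisymm ?_ ((isLagrangeMultiplier_iff.1 hL).2 P hP.1)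
  rw [lagrangian, hopt]
  gcongr
  exact hP.2

variable (κ ρ n) in
/-- The pairs of real numbers that dominate `(ℓ(P), I(P))` for some causal `P`. -/
def achievableRegion : Set (ℝ × ℝ) :=
  {p | 0 ≤ p.1 ∧ 0 ≤ p.2 ∧ ∃ P ∈ causalKernels κ n, avgDistortion κ ρ n P ≤ ENNReal.ofReal p.1 ∧
    mutualInfo (sourceLaw κ (n + 1)) P ≤ ENNReal.ofReal p.2}

theorem convex_achievableRegion [∀ i, StandardBorelSpace (Y i)] [∀ i, IsMarkovKernel (κ i)] :
    Convex ℝ (achievableRegion κ ρ n) := by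
  rintro p ⟨hp₁, hp₂, P, hP, hℓP, hIP⟩ p' ⟨hp₁', hp₂', P', hP', hℓP', hIP'⟩ a b ha hb hab
  lift a to ℝ≥0 using ha
  lift b to ℝ≥0 using hb
  obtain ⟨Q, hQ, hℓQ, hIQ⟩ := exists_mem_causalKernels_avgDistortion_eq_add_mutualInfo_le κ ρ
    hP hP' (a := a) (b := b) (by exact_mod_cast hab)
  have hofReal {x y : ℝ} (hx : 0 ≤ x) (hy : 0 ≤ y) : ENNReal.ofReal (a * x + b * y) =
      a * ENNReal.ofReal x + b * ENNReal.ofReal y := by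
    rw [ENNReal.ofReal_add (by positivity) (by positivity), ENNReal.ofReal_mul a.coe_nonneg,
      ENNReal.ofReal_mul b.coe_nonneg, ENNReal.ofReal_coe_nnreal, ENNReal.ofReal_coe_nnreal]
  refine ⟨add_nonneg (mul_nonneg a.2 hp₁) (mul_nonneg b.2 hp₁'),
    add_nonneg (mul_nonneg a.2 hp₂) (mul_nonneg b.2 hp₂'), Q, hQ, ?_, ?_⟩
  · refine hℓQ.trans_le (le_of_le_of_eq ?_ (hofReal hp₁ hp₁').symm)
    gcongr
  · refine hIQ.trans (le_of_le_of_eq ?_ (hofReal hp₂ hp₂').symm)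
    gcongr

theorem toReal_mem_achievableRegion {P : Kernel (Hist X (n + 1)) (Hist Y (n + 1))}
    (hP : P ∈ causalKernels κ n) (hℓ : avgDistortion κ ρ n P ≠ ∞)
    (hI : mutualInfo (sourceLaw κ (n + 1)) P ≠ ∞) :
    ((avgDistortion κ ρ n P).toReal, (mutualInfo (sourceLaw κ (n + 1)) P).toReal) ∈
      achievableRegion κ ρ n :=
  ⟨ENNReal.toReal_nonneg, ENNReal.toReal_nonneg, P, hP, (ENNReal.ofReal_toReal hℓ).ge,
    (ENNReal.ofReal_toReal hI).ge⟩

theorem exists_mem_achievableRegion_of_causalRDF_lt {r : ℝ≥0∞} (h : causalRDF κ ρ n D < r) :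
    ∃ p ∈ achievableRegion κ ρ n, p.1 ≤ D ∧ ENNReal.ofReal p.2 < r := by
  obtain ⟨P, hP, hI⟩ : ∃ P ∈ fidelitySet κ ρ n D, mutualInfo (sourceLaw κ (n + 1)) P < r := by
    simpa only [causalRDF, iInf_lt_iff, exists_prop] using h
  refine ⟨_, toReal_mem_achievableRegion hP.1 (ne_top_of_le_ne_top ENNReal.coe_ne_top hP.2)
    hI.ne_top, ENNReal.toReal_le_coe_of_le_coe hP.2, ?_⟩
  rwa [ENNReal.ofReal_toReal hI.ne_top]

theorem toReal_causalRDF_le_of_mem_achievableRegion {p : ℝ × ℝ}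
    (hp : p ∈ achievableRegion κ ρ n) (hD : p.1 ≤ D) : (causalRDF κ ρ n D).toReal ≤ p.2 := by
  obtain ⟨-, hp₂, P, hP, hℓ, hI⟩ := hp
  have hℓD : avgDistortion κ ρ n P ≤ D :=
    hℓ.trans (ENNReal.ofReal_le_of_le_toReal hD)
  exact ENNReal.toReal_le_of_le_ofReal hp₂ ((iInf₂_le P ⟨hP, hℓD⟩).trans hI)

theorem antitone_causalRDF : Antitone (causalRDF κ ρ n) := fun _ _ hD ↦
  biInf_mono fun _ hP ↦ ⟨hP.1, hP.2.trans (ENNReal.coe_le_coe.2 hD)⟩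

theorem isLagrangeMultiplier_of_supporting_line (hs : s < 0) (hR : causalRDF κ ρ n D ≠ ∞)
    (hline : ∀ p ∈ achievableRegion κ ρ n,
      (causalRDF κ ρ n D).toReal + s * (p.1 - D) ≤ p.2) :
    IsLagrangeMultiplier κ ρ n D s := by
  refine isLagrangeMultiplier_iff.2 ⟨hs.le, fun P hP ↦ ?_⟩
  have hs' : ENNReal.ofReal (-s) ≠ 0 := (ENNReal.ofReal_pos.2 (neg_pos.2 hs)).ne'
  rw [lagrangian]
  by_cases hℓ : avgDistortion κ ρ n P = ∞
  · simp [hℓ, ENNReal.mul_top hs']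
  by_cases hI : mutualInfo (sourceLaw κ (n + 1)) P = ∞
  · simp [hI]
  have hP_above := hline _ (toReal_mem_achievableRegion hP hℓ hI)
  have hDtop : ENNReal.ofReal (-s) * D ≠ ∞ :=
    ENNReal.mul_ne_top ENNReal.ofReal_ne_top ENNReal.coe_ne_top
  have hℓtop := ENNReal.mul_ne_top (ENNReal.ofReal_ne_top (r := -s)) hℓ
  rw [← ENNReal.toReal_le_toReal (ENNReal.add_ne_top.2 ⟨hR, hDtop⟩)
    (ENNReal.add_ne_top.2 ⟨hI, hℓtop⟩), ENNReal.toReal_add hR hDtop, ENNReal.toReal_add hI hℓtop,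
    ENNReal.toReal_mul, ENNReal.toReal_mul, ENNReal.toReal_ofReal (neg_nonneg.2 hs.le),
    ENNReal.coe_toReal]
  linarith

theorem exists_isLagrangeMultiplier [∀ i, StandardBorelSpace (Y i)] [∀ i, IsMarkovKernel (κ i)]
    (hfinite : ∃ D₁ < D, causalRDF κ ρ n D₁ ≠ ∞)
    (hdecrease : causalRDF κ ρ n D = 0 ∨ ∃ D₂, causalRDF κ ρ n D₂ < causalRDF κ ρ n D) :
    ∃ s : ℝ, IsLagrangeMultiplier κ ρ n D s := by
  rcases hdecrease with hzero | ⟨D₂, hD₂⟩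
  · exact ⟨0, isLagrangeMultiplier_iff.2 ⟨le_rfl, fun P _ ↦ by simp [hzero]⟩⟩
  obtain ⟨D₁, hD₁, hfin⟩ := hfinite
  have hR : causalRDF κ ρ n D ≠ ∞ := ne_top_of_le_ne_top hfin (antitone_causalRDF hD₁.le)
  have hleft : ∃ p ∈ achievableRegion κ ρ n, p.1 < D := by
    obtain ⟨p, hp, hpD₁, -⟩ := exists_mem_achievableRegion_of_causalRDF_lt hfin.lt_top
    exact ⟨p, hp, hpD₁.trans_lt hD₁⟩
  have hbelow : ∃ p ∈ achievableRegion κ ρ n, p.2 < (causalRDF κ ρ n D).toReal := by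
    obtain ⟨p, hp, -, hpR⟩ := exists_mem_achievableRegion_of_causalRDF_lt hD₂
    exact ⟨p, hp, (ENNReal.ofReal_lt_iff_lt_toReal hp.2.1 hR).1 hpR⟩
  obtain ⟨s, hs, hline⟩ := exists_neg_slope_supporting_line convex_achievableRegion
    (fun p ↦ toReal_causalRDF_le_of_mem_achievableRegion) hleft hbelow
  exact ⟨s, isLagrangeMultiplier_of_supporting_line hs hR hline⟩

end Multiplier

section Optimality

variable {X : ℕ → Type u} {Y : ℕ → Type v}
  [∀ i, MeasurableSpace (X i)] [∀ i, MeasurableSpace (Y i)]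
  {κ : ∀ i, Kernel (Hist X i) (X i)} [∀ i, IsMarkovKernel (κ i)]
  {q : ∀ i, Kernel (Hist X (i + 1) × Hist Y i) (Y i)} [∀ i, IsMarkovKernel (q i)]

theorem ae_ae_of_ae_preLaw {m : ℕ} {p : Hist X (m + 1) × Hist Y m → Prop}
    (h : ∀ᵐ w ∂(preLaw κ q m), p w) :
    ∀ᵐ h ∂(jointLaw κ q m), ∀ᵐ x ∂(κ m h.1), p (h.1.snoc x, h.2) := by
  rw [preLaw_eq_map] at h
  have hsource := Measure.ae_ae_of_ae_compProd (p := fun z ↦ p (insertSource X Y m z))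
    (ae_of_ae_map (insertSource X Y m).measurable.aemeasurable h)
  filter_upwards [hsource] with z hz
  rwa [Kernel.comap_apply] at hz

theorem integral_preLaw {m : ℕ} {f : Hist X (m + 1) × Hist Y m → ℝ}
    (hf : Integrable f (preLaw κ q m)) :
    ∫ w, f w ∂(preLaw κ q m) =
      ∫ h, ∫ x, f (h.1.snoc x, h.2) ∂(κ m h.1) ∂(jointLaw κ q m) := by
  rw [preLaw_eq_map] at hf ⊢
  rw [integrable_map_equiv] at hf
  rw [integral_map_equiv, Measure.integral_compProd (f := fun z ↦ f (insertSource X Y m z)) hf]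
  rfl

theorem integral_integral_toReal_sub_toReal {m : ℕ} {f₁ f₂ : Hist X (m + 1) × Hist Y m → ℝ≥0∞}
    (hf₁ : Measurable f₁) (hf₂ : Measurable f₂) (hfin₁ : ∫⁻ w, f₁ w ∂(preLaw κ q m) ≠ ∞)
    (hfin₂ : ∫⁻ w, f₂ w ∂(preLaw κ q m) ≠ ∞) :
    ∫ h, ∫ x, ((f₁ (h.1.snoc x, h.2)).toReal - (f₂ (h.1.snoc x, h.2)).toReal)
        ∂(κ m h.1) ∂(jointLaw κ q m) =
      (∫⁻ w, f₁ w ∂(preLaw κ q m)).toReal - (∫⁻ w, f₂ w ∂(preLaw κ q m)).toReal := by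
  have hint₁ := integrable_toReal_of_lintegral_ne_top hf₁.aemeasurable hfin₁
  have hint₂ := integrable_toReal_of_lintegral_ne_top hf₂.aemeasurable hfin₂
  rw [← integral_toReal hf₁.aemeasurable (ae_lt_top hf₁ hfin₁),
    ← integral_toReal hf₂.aemeasurable (ae_lt_top hf₂ hfin₂), ← integral_sub hint₁ hint₂,
    integral_preLaw (f := fun w ↦ (f₁ w).toReal - (f₂ w).toReal) (hint₁.sub hint₂)]

variable {ρ : ∀ i, Hist X (i + 1) → Hist Y (i + 1) → ℝ≥0}
  {ν : ∀ i, Kernel (Hist Y i) (Y i)} [∀ i, IsMarkovKernel (ν i)] {s : ℝ} {n : ℕ}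

theorem stageFreeEnergy_eq_lintegral_jointLaw (hρ : ∀ i, Measurable (Function.uncurry (ρ i)))
    (hs : s ≤ 0) (i : ℕ) : stageFreeEnergy κ ρ ν s n q i =
      ∫⁻ h, ∫⁻ x, negLog (partitionFn κ ρ ν s n i (h.1.snoc x) h.2)
        ∂(κ i h.1) ∂(jointLaw κ q i) :=
  lintegral_preLaw κ q i (measurable_negLog_partitionFn hρ hs n i)

theorem measurable_lintegral_g (hρ : ∀ i, Measurable (Function.uncurry (ρ i))) (hs : s ≤ 0)
    (i : ℕ) : Measurable fun w : Hist X (i + 1) × Hist Y i ↦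
      ∫⁻ y, g κ ρ ν s n i w.1 (w.2.snoc y) ∂(q i w) :=
  Measurable.lintegral_kernel_prod_right
    (f := fun (w : Hist X (i + 1) × Hist Y i) y ↦ g κ ρ ν s n i w.1 (w.2.snoc y))
    (measurable_g hρ hs n i)

theorem costToGo_eq_lintegral_preLaw (hρ : ∀ i, Measurable (Function.uncurry (ρ i)))
    (hs : s ≤ 0) (i : ℕ) : costToGo κ ρ ν s n q i =
      ∫⁻ w, ∫⁻ y, g κ ρ ν s n i w.1 (w.2.snoc y) ∂(q i w) ∂(preLaw κ q i) :=
  Measure.lintegral_compProd (measurable_g hρ hs n i)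

theorem costToGo_eq_lintegral_jointLaw (hρ : ∀ i, Measurable (Function.uncurry (ρ i)))
    (hs : s ≤ 0) (i : ℕ) : costToGo κ ρ ν s n q i =
      ∫⁻ h, ∫⁻ x, ∫⁻ y, g κ ρ ν s n i (h.1.snoc x) (h.2.snoc y) ∂(q i (h.1.snoc x, h.2))
        ∂(κ i h.1) ∂(jointLaw κ q i) := by
  rw [costToGo_eq_lintegral_preLaw hρ hs, lintegral_preLaw κ q i (measurable_lintegral_g hρ hs i)]

theorem integral_neg_integral_g_sub_log (hρ : ∀ i, Measurable (Function.uncurry (ρ i)))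
    (hs : s ≤ 0) {i : ℕ} (hcost : costToGo κ ρ ν s n q i ≠ ∞)
    (hfree : stageFreeEnergy κ ρ ν s n q i ≠ ∞) :
    ∫ h, ∫ x, (-(∫ y, (g κ ρ ν s n i (h.1.snoc x) (h.2.snoc y)).toReal ∂(q i (h.1.snoc x, h.2)))
        - (ENNReal.log (partitionFn κ ρ ν s n i (h.1.snoc x) h.2)).toReal)
        ∂(κ i h.1) ∂(jointLaw κ q i) =
      (stageFreeEnergy κ ρ ν s n q i).toReal - (costToGo κ ρ ν s n q i).toReal := by
  have hg_meas := measurable_lintegral_g (κ := κ) (q := q) (ν := ν) (n := n) hρ hs i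
  rw [costToGo_eq_lintegral_preLaw hρ hs] at hcost ⊢
  rw [stageFreeEnergy, ← integral_integral_toReal_sub_toReal
    (measurable_negLog_partitionFn hρ hs n i) hg_meas hfree hcost]
  refine integral_congr_ae ?_
  filter_upwards [ae_ae_of_ae_preLaw (ae_lt_top hg_meas hcost)] with h hh
  refine integral_congr_ae ?_
  filter_upwards [hh] with x hx
  rw [toReal_negLog (partitionFn_le_one hs n i _ _), integral_toReal_g hρ hs hx.ne]
  ring

theorem lagrangian_eq_sum_range_stageCost (hρ : ∀ i, Measurable (Function.uncurry (ρ i)))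
    {P : Kernel (Hist X (n + 1)) (Hist Y (n + 1))} [IsMarkovKernel P]
    (hPq : ∀ᵐ x ∂(sourceLaw κ (n + 1)), P x = causalProduct q (n + 1) x)
    (hν : IsOutputConditional κ q n ν) :
    lagrangian κ ρ n s P = ∑ i ∈ Finset.range (n + 1), stageCost κ ρ ν s q i := by
  rw [sum_range_stageCost_eq_klDiv_add q hρ n, lagrangian, mutualInfo, avgDistortion,
    avgDistortion, compProd_eq_jointLaw hPq, ← outputLaw, outputLaw_eq_sourceLaw hν le_rfl]
  rfl

theorem lagrangian_causalProduct_gibbsKernel_le [∀ i, StandardBorelSpace (X i)]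
    (hρ : ∀ i, Measurable (Function.uncurry (ρ i))) (hs : s ≤ 0)
    (q : ∀ i, Kernel (Hist X (i + 1) × Hist Y i) (Y i)) :
    lagrangian κ ρ n s (causalProduct (gibbsKernel κ ρ ν s n) (n + 1)) ≤
      stageFreeEnergy κ ρ ν s n q 0 := by
  have := isMarkovKernel_gibbsKernel (κ := κ) (ν := ν) hρ hs n
  calc lagrangian κ ρ n s (causalProduct (gibbsKernel κ ρ ν s n) (n + 1))
      ≤ ∑ i ∈ Finset.range (n + 1), stageCost κ ρ ν s (gibbsKernel κ ρ ν s n) i := by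
        rw [sum_range_stageCost_eq_klDiv_add _ hρ n, lagrangian]
        gcongr
        exact mutualInfo_le_klDiv_prod _ _ _
    _ = stageFreeEnergy κ ρ ν s n (gibbsKernel κ ρ ν s n) 0 := by
        rw [sum_range_stageCost _ hρ hs n,
          Finset.sum_eq_zero fun i _ ↦ gibbsGap_gibbsKernel hρ hs n i, zero_add]
    -- no reproduction letter precedes stage `0`, so the channel plays no role there
    _ = stageFreeEnergy κ ρ ν s n q 0 := rfl

theorem sum_range_stageCost_eq_causalRDF_add (hρ : ∀ i, Measurable (Function.uncurry (ρ i)))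
    {D : ℝ≥0} {P : Kernel (Hist X (n + 1)) (Hist Y (n + 1))} (hP : P ∈ fidelitySet κ ρ n D)
    (hopt : mutualInfo (sourceLaw κ (n + 1)) P = causalRDF κ ρ n D)
    (hPq : ∀ᵐ x ∂(sourceLaw κ (n + 1)), P x = causalProduct q (n + 1) x)
    (hν : IsOutputConditional κ q n ν) (hL : IsLagrangeMultiplier κ ρ n D s) :
    ∑ i ∈ Finset.range (n + 1), stageCost κ ρ ν s q i =
      causalRDF κ ρ n D + ENNReal.ofReal (-s) * D := by
  have := hP.1.1
  rw [← lagrangian_eq_sum_range_stageCost hρ hPq hν, lagrangian_eq_causalRDF_add hP hopt hL]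

theorem sum_range_stageFreeEnergy_sub_costToGo
    (hρ : ∀ i, Measurable (Function.uncurry (ρ i))) (hs : s ≤ 0) :
    ∑ i ∈ Finset.range (n + 1),
        ((stageFreeEnergy κ ρ ν s n q i).toReal - (costToGo κ ρ ν s n q i).toReal) =
      (stageFreeEnergy κ ρ ν s n q 0).toReal := by
  have hstep : ∀ i ∈ Finset.range n,
      (stageFreeEnergy κ ρ ν s n q i).toReal - (costToGo κ ρ ν s n q i).toReal =
        (stageFreeEnergy κ ρ ν s n q i).toReal - (stageFreeEnergy κ ρ ν s n q (i + 1)).toReal :=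
    fun i hi ↦ by rw [costToGo_eq_stageFreeEnergy_succ q hρ hs (Finset.mem_range.1 hi)]
  rw [Finset.sum_range_succ, Finset.sum_congr rfl hstep, Finset.sum_range_sub', costToGo_self]
  simp

section Minimizer

variable (hρ : ∀ i, Measurable (Function.uncurry (ρ i))) (hs : s ≤ 0)
  (hfin : ∑ i ∈ Finset.range (n + 1), stageCost κ ρ ν s q i ≠ ∞)

include hρ hs hfin

theorem stageFreeEnergy_ne_top {i : ℕ} (hi : i ≤ n) : stageFreeEnergy κ ρ ν s n q i ≠ ∞ := by
  refine ne_top_of_le_ne_top hfin ?_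
  calc stageFreeEnergy κ ρ ν s n q i ≤ ∑ j ∈ Finset.Ico i (n + 1), stageCost κ ρ ν s q j := by
        rw [sum_Ico_stageCost q hρ hs hi]
        exact le_add_self
    _ ≤ ∑ j ∈ Finset.range (n + 1), stageCost κ ρ ν s q j := by
        rw [Finset.range_eq_Ico]
        exact Finset.sum_le_sum_of_subset (Finset.Ico_subset_Ico_left (Nat.zero_le i))

theorem costToGo_ne_top {i : ℕ} (hi : i ≤ n) : costToGo κ ρ ν s n q i ≠ ∞ := by
  rcases hi.eq_or_lt with rfl | hi
  · simp [costToGo_self]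
  · rw [costToGo_eq_stageFreeEnergy_succ q hρ hs hi]
    exact stageFreeEnergy_ne_top hρ hs hfin hi

theorem sum_range_integral_neg_integral_g_sub_log :
    ∑ i ∈ Finset.range (n + 1), ∫ h, ∫ x,
        (-(∫ y, (g κ ρ ν s n i (h.1.snoc x) (h.2.snoc y)).toReal ∂(q i (h.1.snoc x, h.2)))
          - (ENNReal.log (partitionFn κ ρ ν s n i (h.1.snoc x) h.2)).toReal)
        ∂(κ i h.1) ∂(jointLaw κ q i) =
      (stageFreeEnergy κ ρ ν s n q 0).toReal := by
  rw [← sum_range_stageFreeEnergy_sub_costToGo hρ hs]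
  refine Finset.sum_congr rfl fun i hi ↦ ?_
  have hin : i ≤ n := Finset.mem_range_succ_iff.1 hi
  exact integral_neg_integral_g_sub_log hρ hs (costToGo_ne_top hρ hs hfin hin)
    (stageFreeEnergy_ne_top hρ hs hfin hin)

theorem sum_range_gibbsGap_eq_zero [∀ i, StandardBorelSpace (X i)]
    (hmin : ∀ P ∈ causalKernels κ n,
      ∑ i ∈ Finset.range (n + 1), stageCost κ ρ ν s q i ≤ lagrangian κ ρ n s P) :
    ∑ i ∈ Finset.range (n + 1), gibbsGap κ ρ ν s n q i = 0 := by
  have := isMarkovKernel_gibbsKernel (κ := κ) (ν := ν) hρ hs n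
  have hle := (hmin _ (causalProduct_mem_causalKernels κ (gibbsKernel κ ρ ν s n) n)).trans
    (lagrangian_causalProduct_gibbsKernel_le hρ hs q)
  rw [sum_range_stageCost q hρ hs n] at hle
  by_contra hne
  exact (ENNReal.lt_add_right (stageFreeEnergy_ne_top hρ hs hfin n.zero_le) hne).not_ge
    (by rwa [add_comm] at hle)

end Minimizer

theorem ae_eq_withDensity_stageWeight [∀ i, StandardBorelSpace (Y i)]
    (hρ : ∀ i, Measurable (Function.uncurry (ρ i))) (hs : s ≤ 0) {i : ℕ}
    (hgap : gibbsGap κ ρ ν s n q i = 0) (hfree : stageFreeEnergy κ ρ ν s n q i ≠ ∞) :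
    ∀ᵐ h ∂(jointLaw κ q i), ∀ᵐ x ∂(κ i h.1),
      partitionFn κ ρ ν s n i (h.1.snoc x) h.2 ≠ 0 ∧
      partitionFn κ ρ ν s n i (h.1.snoc x) h.2 ≠ ∞ ∧
      q i (h.1.snoc x, h.2) = (partitionFn κ ρ ν s n i (h.1.snoc x) h.2)⁻¹ •
        (ν i h.2).withDensity (stageWeight κ ρ ν s n i (h.1.snoc x) h.2) := by
  have := isMarkovKernel_gibbsKernel (κ := κ) (ν := ν) hρ hs n
  have hgibbs : ∀ᵐ w ∂(preLaw κ q i), q i w = gibbsKernel κ ρ ν s n i w :=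
    Kernel.ae_eq_of_compProd_eq (klDiv_eq_zero_iff.1 hgap)
  have hZ : ∀ᵐ w ∂(preLaw κ q i), partitionFn κ ρ ν s n i w.1 w.2 ≠ 0 := by
    filter_upwards [ae_lt_top (measurable_negLog_partitionFn hρ hs n i) hfree] with w hw hzero
    exact hw.ne (negLog_eq_top_iff.2 hzero)
  filter_upwards [ae_ae_of_ae_preLaw (hgibbs.and hZ)] with h hh
  filter_upwards [hh] with x ⟨hq, hZx⟩
  exact ⟨hZx, ne_top_of_le_ne_top ENNReal.one_ne_top (partitionFn_le_one hs n i _ _),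
    hq.trans (gibbsKernel_apply hρ hs n i hZx)⟩

end Optimality

end CausalRDF

open CausalRDF in
theorem mainTheorem2 {X : ℕ → Type*} {Y : ℕ → Type*}
    [∀ i, MeasurableSpace (X i)] [∀ i, StandardBorelSpace (X i)]
    [∀ i, MeasurableSpace (Y i)] [∀ i, StandardBorelSpace (Y i)]
    (n : ℕ)
    (κ : ∀ i, Kernel (Hist X i) (X i)) [∀ i, IsMarkovKernel (κ i)]
    (ρ : ∀ i, Hist X (i + 1) → Hist Y (i + 1) → ℝ≥0)
    (hρ : ∀ i, Measurable (Function.uncurry (ρ i)))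
    (D : ℝ≥0) :
    -- existence of the Lagrange multiplier
    ((∃ D₁ < D, causalRDF κ ρ n D₁ ≠ ⊤) →
      (causalRDF κ ρ n D = 0 ∨ ∃ D₂, causalRDF κ ρ n D₂ < causalRDF κ ρ n D) →
      ∃ s : ℝ, IsLagrangeMultiplier κ ρ n D s) ∧
    -- form of every optimal reproduction kernel, and of the causal RDF
    (∀ P ∈ fidelitySet κ ρ n D,
      mutualInfo (sourceLaw κ (n + 1)) P = causalRDF κ ρ n D →
      causalRDF κ ρ n D ≠ ⊤ →
      ∀ q : ∀ i, Kernel (Hist X (i + 1) × Hist Y i) (Y i), (∀ i, IsMarkovKernel (q i)) →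
      (∀ᵐ x ∂(sourceLaw κ (n + 1)), P x = causalProduct q (n + 1) x) →
      ∀ ν : ∀ i, Kernel (Hist Y i) (Y i), (∀ i, IsMarkovKernel (ν i)) →
      IsOutputConditional κ q n ν →
      ∀ s : ℝ, IsLagrangeMultiplier κ ρ n D s →
      (∀ i ≤ n, ∀ᵐ h ∂(jointLaw κ q i), ∀ᵐ x ∂(κ i h.1),
        partitionFn κ ρ ν s n i (h.1.snoc x) h.2 ≠ 0 ∧
        partitionFn κ ρ ν s n i (h.1.snoc x) h.2 ≠ ⊤ ∧
        q i (h.1.snoc x, h.2) =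
          (partitionFn κ ρ ν s n i (h.1.snoc x) h.2)⁻¹ •
            (ν i h.2).withDensity (stageWeight κ ρ ν s n i (h.1.snoc x) h.2)) ∧
      (∀ i ≤ n,
        ∫⁻ h, ∫⁻ x, ∫⁻ y, g κ ρ ν s n i (h.1.snoc x) (h.2.snoc y)
          ∂(q i (h.1.snoc x, h.2)) ∂(κ i h.1) ∂(jointLaw κ q i) ≠ ⊤ ∧
        ∫⁻ h, ∫⁻ x, (-ENNReal.log (partitionFn κ ρ ν s n i (h.1.snoc x) h.2)).toENNReal
          ∂(κ i h.1) ∂(jointLaw κ q i) ≠ ⊤) ∧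
      (causalRDF κ ρ n D).toReal = s * D +
        ∑ i ∈ Finset.range (n + 1),
          ∫ h, ∫ x,
            (-(∫ y, (g κ ρ ν s n i (h.1.snoc x) (h.2.snoc y)).toReal
                ∂(q i (h.1.snoc x, h.2)))
              - (ENNReal.log (partitionFn κ ρ ν s n i (h.1.snoc x) h.2)).toReal)
            ∂(κ i h.1) ∂(jointLaw κ q i)) := by
  refine ⟨exists_isLagrangeMultiplier, fun P hP hopt hfin q hq hPq ν hνM hν s hL ↦ ?_⟩
  have hs : s ≤ 0 := hL.1
  have hDtop : ENNReal.ofReal (-s) * D ≠ ∞ :=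
    ENNReal.mul_ne_top ENNReal.ofReal_ne_top ENNReal.coe_ne_top
  have hcost := sum_range_stageCost_eq_causalRDF_add hρ hP hopt hPq hν hL
  have hcost_fin : ∑ i ∈ Finset.range (n + 1), stageCost κ ρ ν s q i ≠ ∞ :=
    hcost ▸ ENNReal.add_ne_top.2 ⟨hfin, hDtop⟩
  have hgap : ∑ i ∈ Finset.range (n + 1), gibbsGap κ ρ ν s n q i = 0 :=
    sum_range_gibbsGap_eq_zero hρ hs hcost_fin (hcost ▸ (isLagrangeMultiplier_iff.1 hL).2)
  have hfree (i : ℕ) (hi : i ≤ n) : stageFreeEnergy κ ρ ν s n q i ≠ ∞ :=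
    stageFreeEnergy_ne_top hρ hs hcost_fin hi
  refine ⟨fun i hi ↦ ?_, fun i hi ↦ ⟨?_, ?_⟩, ?_⟩
  · exact ae_eq_withDensity_stageWeight hρ hs
      (Finset.sum_eq_zero_iff.1 hgap i (Finset.mem_range_succ_iff.2 hi)) (hfree i hi)
  · exact (costToGo_eq_lintegral_jointLaw hρ hs i).symm.trans_ne
      (costToGo_ne_top hρ hs hcost_fin hi)
  · exact (stageFreeEnergy_eq_lintegral_jointLaw hρ hs i).symm.trans_ne (hfree i hi)
  · rw [sum_range_integral_neg_integral_g_sub_log hρ hs hcost_fin,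
      ← zero_add (stageFreeEnergy κ ρ ν s n q 0), ← hgap, ← sum_range_stageCost q hρ hs, hcost,
      ENNReal.toReal_add hfin hDtop, ENNReal.toReal_mul, ENNReal.coe_toReal,
      ENNReal.toReal_ofReal (neg_nonneg.2 hs)]
    ring
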